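/- Let $0<|\lambda|<1$, and let $\mathfrak h(\lambda)=\mathbb R\ltimes_{\mathrm{diag}(1,\lambda)}\mathbb R^2$ be the three-dimensional real Lie algebra with a basis $e_1,e_2,e_3$ satisfying $$[e_1,e_2]=e_2,\qquad [e_1,e_3]=\lambda e_3,\qquad [e_2,e_3]=0 ;$$ any such basis is called a standard basis, and we fix one. Let $q$ be a Lorentzian metric on $\mathfrak h(\lambda)$, that is, a nondegenerate symmetric bilinear form of signature $(+,+,-)$. A vector $v$ is called timelike if $q(v,v)<0$, lightlike if $v\neq 0$ and $q(v,v)=0$, and spacelike if $v=0$ or $q(v,v)>0$. Call $q$ geodesically complete if the left-invariant Lorentzian metric defined by $q$ on the simply connected Lie group $\mathbb R\ltimes\mathbb R^2$ with product $(s,u)(t,v)=(s+t,\,u+e^{s\,\mathrm{diag}(1,\lambda)}v)$, whose Lie algebra is $\mathfrak h(\lambda)$, is geodesically complete, i.e. each initial velocity is that of a geodesic defined on all of $\mathbb R$. The geodesic field of $q$ is the vector field $F$ on $\mathfrak h(\lambda)$ determined by $q(F(v),w)=q(v,[v,w])$ for all $v,w\in\mathfrak h(\lambda)$. Then $q$ is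 geodesically complete if and only if $e_3$ is timelike and $e_2$ is not spacelike. Furthermore, if $e_3$ is timelike, then: (a) if $e_2$ is timelike, every integral curve of the geodesic field (defined on any open interval) is bounded; (b) if $e_2$ is lightlike, there exists an unbounded integral curve of the geodesic field, defined on all of $\mathbb R$. -/

import Mathlib

open Module

noncomputable section

namespace MetricLie

/-! ### The Lie algebra `𝔥(lam)` -/

/-- The underlying space `ℝ³` of the Lie algebra `𝔥(lam) = ℝ ⋉_{diag(1, lam)} ℝ²`. -/
def LieAlg (_lam : ℝ) : Type := Fin 3 → ℝ

instance (lam : ℝ) : NormedAddCommGroup (LieAlg lam) :=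
  inferInstanceAs (NormedAddCommGroup (Fin 3 → ℝ))

instance (lam : ℝ) : NormedSpace ℝ (LieAlg lam) :=
  inferInstanceAs (NormedSpace ℝ (Fin 3 → ℝ))

instance (lam : ℝ) : FiniteDimensional ℝ (LieAlg lam) :=
  inferInstanceAs (FiniteDimensional ℝ (Fin 3 → ℝ))

/-- The Lie bracket `[(s, u), (t, v)] = (0, s A v - t A u)` with `A = diag(1, lam)`. -/
instance (lam : ℝ) : Bracket (LieAlg lam) (LieAlg lam) where
  bracket u v := (![0, u 0 * v 1 - v 0 * u 1, lam * (u 0 * v 2 - v 0 * u 2)] : Fin 3 → ℝ)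

namespace LieAlg

variable {lam : ℝ}

theorem ext {u v : LieAlg lam} (h0 : u 0 = v 0) (h1 : u 1 = v 1) (h2 : u 2 = v 2) : u = v := by
  funext i; fin_cases i <;> assumption

theorem lie_zero_coord (u v : LieAlg lam) : ⁅u, v⁆ 0 = 0 := rfl

theorem lie_one_coord (u v : LieAlg lam) : ⁅u, v⁆ 1 = u 0 * v 1 - v 0 * u 1 := rfl

theorem lie_two_coord (u v : LieAlg lam) : ⁅u, v⁆ 2 = lam * (u 0 * v 2 - v 0 * u 2) := rfl

theorem zero_apply (i : Fin 3) : (0 : LieAlg lam) i = 0 := rfl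

theorem add_apply (u v : LieAlg lam) (i : Fin 3) : (u + v) i = u i + v i := rfl

theorem smul_apply (c : ℝ) (u : LieAlg lam) (i : Fin 3) : (c • u) i = c * u i := rfl

end LieAlg

instance (lam : ℝ) : LieRing (LieAlg lam) where
  add_lie u v w := by
    apply LieAlg.ext <;> simp only [LieAlg.add_apply, LieAlg.lie_zero_coord,
      LieAlg.lie_one_coord, LieAlg.lie_two_coord] <;> ring
  lie_add u v w := by
    apply LieAlg.ext <;> simp only [LieAlg.add_apply, LieAlg.lie_zero_coord,
      LieAlg.lie_one_coord, LieAlg.lie_two_coord] <;> ring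
  lie_self u := by
    apply LieAlg.ext <;> simp only [LieAlg.zero_apply, LieAlg.lie_zero_coord,
      LieAlg.lie_one_coord, LieAlg.lie_two_coord] <;> ring
  leibniz_lie u v w := by
    apply LieAlg.ext <;> simp only [LieAlg.add_apply, LieAlg.lie_zero_coord,
      LieAlg.lie_one_coord, LieAlg.lie_two_coord] <;> ring

instance (lam : ℝ) : LieAlgebra ℝ (LieAlg lam) where
  lie_smul c u v := by
    apply LieAlg.ext <;> simp only [LieAlg.smul_apply, LieAlg.lie_zero_coord,
      LieAlg.lie_one_coord, LieAlg.lie_two_coord] <;> ring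

/-- A standard basis `e₁ = e 0`, `e₂ = e 1`, `e₃ = e 2` of `𝔥(lam)`. -/
def IsStandardBasis {lam : ℝ} (e : Basis (Fin 3) ℝ (LieAlg lam)) : Prop :=
  ⁅e 0, e 1⁆ = e 1 ∧ ⁅e 0, e 2⁆ = lam • e 2 ∧ ⁅e 1, e 2⁆ = 0

/-! ### Lorentzian scalar products -/

section Causal

variable {V : Type*} [AddCommGroup V] [Module ℝ V]

/-- A Lorentzian scalar product on a three-dimensional space: a nondegenerate symmetric bilinear
form of signature `(+, +, -)`. -/
structure IsLorentzian (q : LinearMap.BilinForm ℝ V) : Prop where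
  symm : q.IsSymm
  nondegenerate : q.Nondegenerate
  signature : ∃ f : Basis (Fin 3) ℝ V, ∀ i j : Fin 3,
    q (f i) (f j) = Matrix.diagonal ![(1 : ℝ), 1, -1] i j

def IsTimelike (q : LinearMap.BilinForm ℝ V) (v : V) : Prop := q v v < 0

def IsLightlike (q : LinearMap.BilinForm ℝ V) (v : V) : Prop := v ≠ 0 ∧ q v v = 0

def IsSpacelike (q : LinearMap.BilinForm ℝ V) (v : V) : Prop := v = 0 ∨ 0 < q v v

end Causal

/-- The geodesic (Euler-Arnold) field `v ↦ ad†_v v` of a metric Lie algebra, where `ad†_v` is the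
`q`-transpose of `ad_v`, that is, `q (ad†_v x) y = q x ⁅v, y⁆`. -/
def geodesicField {L : Type*} [LieRing L] [LieAlgebra ℝ L] [FiniteDimensional ℝ L]
    (q : LinearMap.BilinForm ℝ L) (hq : q.Nondegenerate) (v : L) : L :=
  q.leftAdjointOfNondegenerate hq (LieAlgebra.ad ℝ L v) v

theorem geodesicField_spec {L : Type*} [LieRing L] [LieAlgebra ℝ L] [FiniteDimensional ℝ L]
    (q : LinearMap.BilinForm ℝ L) (hq : q.Nondegenerate) (v w : L) :
    q (geodesicField q hq v) w = q v ⁅v, w⁆ :=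
  q.isAdjointPairLeftAdjointOfNondegenerate hq (LieAlgebra.ad ℝ L v) v w

/-! ### The simply connected Lie group `ℝ ⋉_{diag(1, lam)} ℝ²` -/

/-- The underlying manifold `ℝ³` (with its global chart) of the simply connected Lie group with
Lie algebra `𝔥(lam)`. -/
def LieGrp (_lam : ℝ) : Type := Fin 3 → ℝ

instance (lam : ℝ) : NormedAddCommGroup (LieGrp lam) :=
  inferInstanceAs (NormedAddCommGroup (Fin 3 → ℝ))

instance (lam : ℝ) : NormedSpace ℝ (LieGrp lam) :=
  inferInstanceAs (NormedSpace ℝ (Fin 3 → ℝ))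

/-- The product `(s, u) (t, v) = (s + t, u + exp(s A) v)` with `A = diag(1, lam)`. -/
instance (lam : ℝ) : Mul (LieGrp lam) where
  mul a b := (![a 0 + b 0, a 1 + Real.exp (a 0) * b 1,
    a 2 + Real.exp (lam * a 0) * b 2] : Fin 3 → ℝ)

instance (lam : ℝ) : One (LieGrp lam) where
  one := (0 : Fin 3 → ℝ)

instance (lam : ℝ) : Inv (LieGrp lam) where
  inv a := (![-a 0, -(Real.exp (-a 0) * a 1), -(Real.exp (-(lam * a 0)) * a 2)] : Fin 3 → ℝ)

namespace LieGrp

variable {lam : ℝ}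

theorem ext {a b : LieGrp lam} (h0 : a 0 = b 0) (h1 : a 1 = b 1) (h2 : a 2 = b 2) : a = b := by
  funext i; fin_cases i <;> assumption

theorem mul_zero_coord (a b : LieGrp lam) : (a * b) 0 = a 0 + b 0 := rfl

theorem mul_one_coord (a b : LieGrp lam) : (a * b) 1 = a 1 + Real.exp (a 0) * b 1 := rfl

theorem mul_two_coord (a b : LieGrp lam) : (a * b) 2 = a 2 + Real.exp (lam * a 0) * b 2 := rfl

theorem one_apply (i : Fin 3) : (1 : LieGrp lam) i = 0 := rfl

theorem inv_zero_coord (a : LieGrp lam) : a⁻¹ 0 = -a 0 := rfl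

theorem inv_one_coord (a : LieGrp lam) : a⁻¹ 1 = -(Real.exp (-a 0) * a 1) := rfl

theorem inv_two_coord (a : LieGrp lam) : a⁻¹ 2 = -(Real.exp (-(lam * a 0)) * a 2) := rfl

end LieGrp

instance (lam : ℝ) : Group (LieGrp lam) where
  mul_assoc a b c := by
    apply LieGrp.ext <;> simp only [LieGrp.mul_zero_coord, LieGrp.mul_one_coord,
      LieGrp.mul_two_coord, mul_add, Real.exp_add] <;> ring
  one_mul a := by
    apply LieGrp.ext <;> simp [LieGrp.mul_zero_coord, LieGrp.mul_one_coord,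
      LieGrp.mul_two_coord, LieGrp.one_apply]
  mul_one a := by
    apply LieGrp.ext <;> simp [LieGrp.mul_zero_coord, LieGrp.mul_one_coord,
      LieGrp.mul_two_coord, LieGrp.one_apply]
  inv_mul_cancel a := by
    apply LieGrp.ext <;> simp [LieGrp.mul_zero_coord, LieGrp.mul_one_coord,
      LieGrp.mul_two_coord, LieGrp.inv_zero_coord, LieGrp.inv_one_coord, LieGrp.inv_two_coord,
      LieGrp.one_apply]

/-- The coordinates of the group. -/
def LieGrp.coord (lam : ℝ) : LieGrp lam ≃L[ℝ] (Fin 3 → ℝ) :=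
  ContinuousLinearEquiv.refl ℝ (Fin 3 → ℝ)

/-- The coordinates of the Lie algebra. -/
def LieAlg.coord (lam : ℝ) : LieAlg lam ≃L[ℝ] (Fin 3 → ℝ) :=
  ContinuousLinearEquiv.refl ℝ (Fin 3 → ℝ)

/-- The identification of the tangent space of the group at the identity with `𝔥(lam)`, in
coordinates. -/
def toLieAlg (lam : ℝ) : LieGrp lam ≃L[ℝ] LieAlg lam :=
  (LieGrp.coord lam).trans (LieAlg.coord lam).symm

/-- The left-invariant vector field `p ↦ d(L_p)₁ v` generated by `v ∈ 𝔥(lam)`. -/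
def leftInvariantField {lam : ℝ} (v : LieAlg lam) (p : LieGrp lam) : LieGrp lam :=
  fderiv ℝ (fun x : LieGrp lam => p * x) 1 ((toLieAlg lam).symm v)

/-- A map into the group is differentiable if its coordinates are. -/
theorem LieGrp.hasFDerivAt_of_coord {lam : ℝ} {f : LieGrp lam → LieGrp lam} {x : LieGrp lam}
    {L : Fin 3 → (Fin 3 → ℝ) →L[ℝ] ℝ}
    (h : ∀ i, HasFDerivAt (fun y : Fin 3 → ℝ => f ((LieGrp.coord lam).symm y) i) (L i)
      (LieGrp.coord lam x)) :
    HasFDerivAt f (((LieGrp.coord lam).symm : (Fin 3 → ℝ) →L[ℝ] LieGrp lam) ∘L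
      (ContinuousLinearMap.pi L) ∘L (LieGrp.coord lam : LieGrp lam →L[ℝ] (Fin 3 → ℝ))) x := by
  have h1 : HasFDerivAt (fun y : Fin 3 → ℝ => LieGrp.coord lam (f ((LieGrp.coord lam).symm y)))
      (ContinuousLinearMap.pi L) (LieGrp.coord lam x) := hasFDerivAt_pi.2 h
  exact (LieGrp.coord lam).symm.hasFDerivAt.comp x
    (h1.comp x (LieGrp.coord lam).hasFDerivAt)

theorem hasFDerivAt_mul_left {lam : ℝ} (p x : LieGrp lam) :
    HasFDerivAt (fun x : LieGrp lam => p * x)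
      (((LieGrp.coord lam).symm : (Fin 3 → ℝ) →L[ℝ] LieGrp lam) ∘L
        (ContinuousLinearMap.pi ![ContinuousLinearMap.proj 0,
          Real.exp (p 0) • ContinuousLinearMap.proj 1,
          Real.exp (lam * p 0) • ContinuousLinearMap.proj 2]) ∘L
        (LieGrp.coord lam : LieGrp lam →L[ℝ] (Fin 3 → ℝ))) x := by
  apply LieGrp.hasFDerivAt_of_coord
  intro i
  fin_cases i
  · exact (hasFDerivAt_apply (𝕜 := ℝ) (F' := fun _ : Fin 3 => ℝ) 0 _).const_add (p 0)
  · exact ((hasFDerivAt_apply (𝕜 := ℝ) (F' := fun _ : Fin 3 => ℝ) 1 _).const_mul _).const_add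
      (p 1)
  · exact ((hasFDerivAt_apply (𝕜 := ℝ) (F' := fun _ : Fin 3 => ℝ) 2 _).const_mul _).const_add
      (p 2)

/-- Coordinate expression of the left-invariant fields. -/
theorem leftInvariantField_eq {lam : ℝ} (v : LieAlg lam) (p : LieGrp lam) :
    leftInvariantField v p = (LieGrp.coord lam).symm
      ![v 0, Real.exp (p 0) * v 1, Real.exp (lam * p 0) * v 2] := by
  unfold leftInvariantField
  rw [(hasFDerivAt_mul_left p 1).fderiv]
  apply LieGrp.ext <;> rfl

/-- `𝔥(lam)` is the Lie algebra of the group: its bracket is the commutator of the corresponding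
left-invariant vector fields, evaluated at the identity. -/
theorem lieBracket_leftInvariantField {lam : ℝ} (u v : LieAlg lam) :
    toLieAlg lam (VectorField.lieBracket ℝ (leftInvariantField u) (leftInvariantField v) 1)
      = ⁅u, v⁆ := by
  have key : ∀ w : LieAlg lam, HasFDerivAt (leftInvariantField w)
      (((LieGrp.coord lam).symm : (Fin 3 → ℝ) →L[ℝ] LieGrp lam) ∘L
        (ContinuousLinearMap.pi ![0, w 1 • ContinuousLinearMap.proj 0,
          (lam * w 2) • ContinuousLinearMap.proj 0]) ∘L
        (LieGrp.coord lam : LieGrp lam →L[ℝ] (Fin 3 → ℝ))) 1 := by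
    intro w
    have e : leftInvariantField w = fun p : LieGrp lam => (LieGrp.coord lam).symm
        ![w 0, Real.exp (p 0) * w 1, Real.exp (lam * p 0) * w 2] :=
      funext fun p => leftInvariantField_eq w p
    have h0 := hasFDerivAt_apply (𝕜 := ℝ) (F' := fun _ : Fin 3 => ℝ) (0 : Fin 3) 0
    rw [e]
    apply LieGrp.hasFDerivAt_of_coord
    intro i
    fin_cases i
    · exact hasFDerivAt_const (w 0) _
    · have h := h0.exp.mul_const (w 1)
      simp only [Pi.zero_apply, Real.exp_zero, one_smul] at h
      exact h
    · have h := (h0.const_mul lam).exp.mul_const (w 2)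
      simp only [Pi.zero_apply, mul_zero, Real.exp_zero, smul_smul, one_mul, mul_comm (w 2) lam] at h
      exact h
  have h1 : ∀ w : LieAlg lam, leftInvariantField w 1 = (toLieAlg lam).symm w := by
    intro w
    rw [leftInvariantField_eq]
    apply LieGrp.ext
    · rfl
    · change Real.exp 0 * w 1 = w 1
      simp
    · change Real.exp (lam * 0) * w 2 = w 2
      simp
  rw [VectorField.lieBracket, (key u).fderiv, (key v).fderiv, h1, h1]
  apply LieAlg.ext
  · exact sub_zero (0 : ℝ)
  · change v 1 * u 0 - u 1 * v 0 = u 0 * v 1 - v 0 * u 1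
    ring
  · change lam * v 2 * u 0 - lam * u 2 * v 0 = lam * (u 0 * v 2 - v 0 * u 2)
    ring

/-- Left translation of tangent vectors at `p` to the identity. -/
def leftTrivialization {lam : ℝ} (p : LieGrp lam) : LieGrp lam →L[ℝ] LieAlg lam :=
  (toLieAlg lam : LieGrp lam →L[ℝ] LieAlg lam).comp
    (fderiv ℝ (fun x : LieGrp lam => p⁻¹ * x) p)

/-- The left-invariant metric on the group determined by a bilinear form on `𝔥(lam)`. -/
def leftInvariantMetric {lam : ℝ} (q : LinearMap.BilinForm ℝ (LieAlg lam))
    (p v w : LieGrp lam) : ℝ :=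
  q (leftTrivialization p v) (leftTrivialization p w)

/-! ### Geodesics of a metric in a global chart -/

section Geodesics

variable {E : Type*} [NormedAddCommGroup E] [NormedSpace ℝ E]

/-- The Christoffel symbol of the first kind,
`½ (∂_u g(v, w) + ∂_v g(u, w) - ∂_w g(u, v))` for constant `u`, `v`, `w`, which equals
`g(∇_u v, w)` for the Levi-Civita connection `∇`. -/
def christoffelFirst (g : E → E → E → ℝ) (p u v w : E) : ℝ :=
  (fderiv ℝ (fun x => g x v w) p u + fderiv ℝ (fun x => g x u w) p v
    - fderiv ℝ (fun x => g x u v) p w) / 2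

/-- `γ : ℝ → E` is a geodesic: `∇_{γ'} γ' = 0`, paired with an arbitrary vector `w`. -/
def IsGeodesic (g : E → E → E → ℝ) (γ : ℝ → E) : Prop :=
  ContDiff ℝ 2 γ ∧ ∀ (t : ℝ) (w : E),
    g (γ t) (deriv (deriv γ) t) w + christoffelFirst g (γ t) (deriv γ t) (deriv γ t) w = 0

/-- Geodesic completeness: each initial velocity is the initial velocity of a geodesic defined
on the whole of `ℝ`. -/
def IsGeodesicallyComplete (g : E → E → E → ℝ) : Prop :=
  ∀ p v : E, ∃ γ : ℝ → E, IsGeodesic g γ ∧ γ 0 = p ∧ deriv γ 0 = v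

end Geodesics

end MetricLie

end

open Module

noncomputable section

namespace MetricLie

variable {lam : ℝ}

/-! ### Gram matrices in the coordinate basis -/

/-! A standard basis is rigid: its second and third vectors are multiples of the coordinate vectors,
so both causal conditions are sign conditions on the Gram entries g₁₁ = `gram q 1 1` and g₂₂ = `gram
q 2 2`, written with the 0-based indices of the code.

Left trivialization turns geodesics into solutions V of the Euler-Arnold equation. Let x be a
primitive of the first coordinate of V. Since the derived plane is abelian, the two momenta along it
solve scalar linear equations and equal A e^x and B e^{lam x}. Conservation of the energy E = q(V,
V) then leaves a one-dimensional motion (`gramDet_mul_sq_eq`) -D x'² = g₂₂ A² e^{2x} - 2 g₁₂ AB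
e^{(1+lam)x} + g₁₁ B² e^{2 lam x} - ΔE, with D = `gramDet q` < 0 and Δ = `planeDet q`. Everything
follows from the growth of the right-hand side.

If g₂₂ < 0 and g₁₁ ≤ 0, the mixed term is harmless, because 0 < 1 + lam < 2: it is bounded on the
left and beaten by e^{2x} on the right (`exists_mul_exp_le`). The right-hand side is bounded above,
so x' is bounded, the motion is global (`exists_global_motion`), and the geodesic is recovered by
quadrature. If moreover g₁₁ < 0, the same identity bounds x' and both momenta, hence V. If g₁₁ = 0,
an explicit solution with x' = 1 and A = 0 is unbounded.

Conversely, if g₁₁ > 0, if g₂₂ > 0, or if g₂₂ = 0 and g₁₁ ≤ 0, suitable A, B and E force C x'² ≥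
e^{2μx} with μ ≠ 0, in the last case only for x ≥ 0 but with x'(0) > 0. Then e^{-μx} is positive
while its derivative stays away from 0, which is impossible for all time. -/

/-- The coordinate basis of `𝔥(lam)`. -/
def coordBasis (lam : ℝ) : Basis (Fin 3) ℝ (LieAlg lam) :=
  (Pi.basisFun ℝ (Fin 3)).map (LieAlg.coord lam).symm.toLinearEquiv

theorem coordBasis_apply (i j : Fin 3) : coordBasis lam i j = if j = i then 1 else 0 := by
  have : coordBasis lam i j = (Pi.single i (1 : ℝ) : Fin 3 → ℝ) j := by
    simp only [coordBasis, Basis.map_apply, Pi.basisFun_apply]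
    rfl
  rw [this, Pi.single_apply]

theorem eq_sum_coordBasis (v : LieAlg lam) :
    v = v 0 • coordBasis lam 0 + v 1 • coordBasis lam 1 + v 2 • coordBasis lam 2 := by
  apply LieAlg.ext <;> simp [LieAlg.add_apply, LieAlg.smul_apply, coordBasis_apply]

theorem lie_eq_sum_coordBasis (v w : LieAlg lam) :
    ⁅v, w⁆ = (v 0 * w 1 - w 0 * v 1) • coordBasis lam 1
      + (lam * (v 0 * w 2 - w 0 * v 2)) • coordBasis lam 2 := by
  apply LieAlg.ext <;> simp [LieAlg.add_apply, LieAlg.smul_apply, coordBasis_apply,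
    LieAlg.lie_zero_coord, LieAlg.lie_one_coord, LieAlg.lie_two_coord]

/-- The second vector of a standard basis spans the second coordinate axis, the third vector spans
the third one. -/
theorem IsStandardBasis.exists_smul (hlam0 : lam ≠ 0) (hlam1 : |lam| < 1)
    {e : Basis (Fin 3) ℝ (LieAlg lam)} (he : IsStandardBasis e) :
    (∃ b : ℝ, b ≠ 0 ∧ e 1 = b • coordBasis lam 1) ∧
      ∃ c : ℝ, c ≠ 0 ∧ e 2 = c • coordBasis lam 2 := by
  obtain ⟨h1, h2, -⟩ := he
  obtain ⟨hl, hu⟩ := abs_lt.1 hlam1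
  have h10 : e 1 0 = 0 := by rw [← h1]; rfl
  have h11 : e 0 0 * e 1 1 = e 1 1 := by
    have := congrArg (fun v : LieAlg lam => v 1) h1
    simpa [LieAlg.lie_one_coord, h10] using this
  have h12 : lam * (e 0 0 * e 1 2) = e 1 2 := by
    have := congrArg (fun v : LieAlg lam => v 2) h1
    simpa [LieAlg.lie_two_coord, h10] using this
  have h20 : e 2 0 = 0 := by
    have := congrArg (fun v : LieAlg lam => v 0) h2
    simpa [LieAlg.lie_zero_coord, LieAlg.smul_apply, hlam0] using this
  have h21 : e 0 0 * e 2 1 = lam * e 2 1 := by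
    have := congrArg (fun v : LieAlg lam => v 1) h2
    simpa [LieAlg.lie_one_coord, LieAlg.smul_apply, h20] using this
  have h22 : e 0 0 * e 2 2 = e 2 2 := by
    have := congrArg (fun v : LieAlg lam => v 2) h2
    simpa [LieAlg.lie_two_coord, LieAlg.smul_apply, h20, hlam0] using this
  have hne1 := e.ne_zero 1
  have hne2 := e.ne_zero 2
  -- The only alternative would be that `e 1` and `e 2` swap the eigenlines of diag(1, lam); that
  -- forces both lam * `e 0 0` = 1 and `e 0 0` = lam, so lam² = 1.
  have h00 : e 0 0 = 1 := by
    by_contra hne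
    have e11 : e 1 1 = 0 := by
      by_contra h; exact hne (mul_right_cancel₀ h (by rw [h11, one_mul]))
    have e22 : e 2 2 = 0 := by
      by_contra h; exact hne (mul_right_cancel₀ h (by rw [h22, one_mul]))
    have e12 : e 1 2 ≠ 0 := fun h => hne1 (LieAlg.ext h10 e11 h)
    have e21 : e 2 1 ≠ 0 := fun h => hne2 (LieAlg.ext h20 h e22)
    have a1 : lam * e 0 0 = 1 := mul_right_cancel₀ e12 (by rw [one_mul, mul_assoc, h12])
    have a2 : e 0 0 = lam := mul_right_cancel₀ e21 h21
    rw [a2] at a1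
    nlinarith
  rw [h00, one_mul] at h12 h21
  have e12 : e 1 2 = 0 := by
    have : (lam - 1) * e 1 2 = 0 := by linarith
    exact (mul_eq_zero.1 this).resolve_left (by linarith)
  have e21 : e 2 1 = 0 := by
    have : (lam - 1) * e 2 1 = 0 := by linarith
    exact (mul_eq_zero.1 this).resolve_left (by linarith)
  refine ⟨⟨e 1 1, fun h => hne1 (LieAlg.ext h10 h e12), ?_⟩,
    ⟨e 2 2, fun h => hne2 (LieAlg.ext h20 e21 h), ?_⟩⟩
  · apply LieAlg.ext <;> simp [LieAlg.smul_apply, coordBasis_apply, h10, e12]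
  · apply LieAlg.ext <;> simp [LieAlg.smul_apply, coordBasis_apply, h20, e21]

/-- The entries of the Gram matrix of `q` in the coordinate basis. -/
def gram (q : LinearMap.BilinForm ℝ (LieAlg lam)) (i j : Fin 3) : ℝ :=
  q (coordBasis lam i) (coordBasis lam j)

/-- The Gram determinant of `q` on the derived algebra. -/
def planeDet (q : LinearMap.BilinForm ℝ (LieAlg lam)) : ℝ :=
  gram q 1 1 * gram q 2 2 - gram q 1 2 ^ 2

/-- The Gram determinant of a symmetric form `q`. -/
def gramDet (q : LinearMap.BilinForm ℝ (LieAlg lam)) : ℝ :=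
  gram q 0 0 * planeDet q - gram q 0 1 * (gram q 0 1 * gram q 2 2 - gram q 1 2 * gram q 0 2)
    + gram q 0 2 * (gram q 0 1 * gram q 1 2 - gram q 1 1 * gram q 0 2)

/-! ### Energy, momenta and coordinates of a vector -/

section Symmetric

variable {q : LinearMap.BilinForm ℝ (LieAlg lam)}

theorem gram_comm (hq : q.IsSymm) (i j : Fin 3) : gram q i j = gram q j i :=
  hq.eq _ _

theorem apply_coordBasis_zero (hq : q.IsSymm) (v : LieAlg lam) :
    q v (coordBasis lam 0) = v 0 * gram q 0 0 + v 1 * gram q 0 1 + v 2 * gram q 0 2 := by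
  rw [gram_comm hq 0 1, gram_comm hq 0 2]
  conv_lhs => rw [eq_sum_coordBasis v]
  simp [gram]

theorem apply_coordBasis_one (hq : q.IsSymm) (v : LieAlg lam) :
    q v (coordBasis lam 1) = v 0 * gram q 0 1 + v 1 * gram q 1 1 + v 2 * gram q 1 2 := by
  rw [gram_comm hq 1 2]
  conv_lhs => rw [eq_sum_coordBasis v]
  simp [gram]

theorem apply_coordBasis_two (v : LieAlg lam) :
    q v (coordBasis lam 2) = v 0 * gram q 0 2 + v 1 * gram q 1 2 + v 2 * gram q 2 2 := by
  conv_lhs => rw [eq_sum_coordBasis v]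
  simp [gram]

theorem apply_eq_sum (v w : LieAlg lam) :
    q v w = w 0 * q v (coordBasis lam 0) + w 1 * q v (coordBasis lam 1)
      + w 2 * q v (coordBasis lam 2) := by
  conv_lhs => rw [eq_sum_coordBasis w]
  simp

theorem apply_lie_eq (u v w : LieAlg lam) :
    q u ⁅v, w⁆ = (v 0 * w 1 - w 0 * v 1) * q u (coordBasis lam 1)
      + lam * (v 0 * w 2 - w 0 * v 2) * q u (coordBasis lam 2) := by
  rw [lie_eq_sum_coordBasis]
  simp

/-- The quadratic form dual to `q` on the derived algebra, up to the factor `planeDet q`. -/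
def dualForm (q : LinearMap.BilinForm ℝ (LieAlg lam)) (a b : ℝ) : ℝ :=
  gram q 2 2 * a ^ 2 - 2 * gram q 1 2 * (a * b) + gram q 1 1 * b ^ 2

/-- When `planeDet q` ≠ 0 this splits v into its part in the derived plane and its part orthogonal
to it; clearing denominators keeps the identity valid for a degenerate plane. -/
theorem gramDet_mul_sq (hq : q.IsSymm) (v : LieAlg lam) :
    gramDet q * v 0 ^ 2 = planeDet q * q v v
      - dualForm q (q v (coordBasis lam 1)) (q v (coordBasis lam 2)) := by
  rw [apply_eq_sum v v, apply_coordBasis_zero hq, apply_coordBasis_one hq, apply_coordBasis_two,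
    gramDet, planeDet, dualForm]
  ring

/-- Cramer's rule. It also serves in reverse, to choose the momentum along e₁ that produces a
prescribed first coordinate. -/
theorem gramDet_mul_coord_zero (hq : q.IsSymm) (v : LieAlg lam) :
    gramDet q * v 0 = planeDet q * q v (coordBasis lam 0)
      + (gram q 0 2 * gram q 1 2 - gram q 0 1 * gram q 2 2) * q v (coordBasis lam 1)
      + (gram q 0 1 * gram q 1 2 - gram q 0 2 * gram q 1 1) * q v (coordBasis lam 2) := by
  rw [apply_coordBasis_zero hq, apply_coordBasis_one hq, apply_coordBasis_two,
    gramDet, planeDet]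
  ring

theorem planeDet_mul_coord_one (hq : q.IsSymm) (v : LieAlg lam) :
    planeDet q * v 1 = gram q 2 2 * (q v (coordBasis lam 1) - gram q 0 1 * v 0)
      - gram q 1 2 * (q v (coordBasis lam 2) - gram q 0 2 * v 0) := by
  rw [apply_coordBasis_one hq, apply_coordBasis_two, planeDet]
  ring

theorem planeDet_mul_coord_two (hq : q.IsSymm) (v : LieAlg lam) :
    planeDet q * v 2 = gram q 1 1 * (q v (coordBasis lam 2) - gram q 0 2 * v 0)
      - gram q 1 2 * (q v (coordBasis lam 1) - gram q 0 1 * v 0) := by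
  rw [apply_coordBasis_one hq, apply_coordBasis_two, planeDet]
  ring

end Symmetric

/-! ### Signs forced by the Lorentzian signature -/

section Lorentzian

variable {q : LinearMap.BilinForm ℝ (LieAlg lam)}

/-- A Lorentzian form in coordinates of an orthonormal basis. -/
theorem IsLorentzian.exists_coord (hq : IsLorentzian q) :
    ∃ f : Basis (Fin 3) ℝ (LieAlg lam), ∀ v w, q v w =
      f.repr v 0 * f.repr w 0 + f.repr v 1 * f.repr w 1 - f.repr v 2 * f.repr w 2 := by
  obtain ⟨f, hf⟩ := hq.signature
  refine ⟨f, fun v w => ?_⟩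
  conv_lhs => rw [← f.sum_repr v, ← f.sum_repr w]
  simp only [Fin.sum_univ_three, map_add, map_smul, LinearMap.add_apply, LinearMap.smul_apply, hf]
  simp
  ring

theorem IsLorentzian.gramDet_neg (hq : IsLorentzian q) : gramDet q < 0 := by
  obtain ⟨f, hf⟩ := hq.exists_coord
  have hu : IsUnit (f.det (coordBasis lam)) := f.isUnit_det _
  have : gramDet q = -f.det (coordBasis lam) ^ 2 := by
    rw [Basis.det_apply, Matrix.det_fin_three]
    simp only [Basis.toMatrix_apply, gramDet, planeDet, gram, hf]
    ring
  rw [this]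
  exact neg_neg_of_pos (sq_pos_of_ne_zero hu.ne_zero)

/-- The reverse Cauchy-Schwarz inequality. -/
theorem IsLorentzian.mul_le_sq (hq : IsLorentzian q) {u : LieAlg lam} (hu : q u u < 0)
    (w : LieAlg lam) : q u u * q w w ≤ q u w ^ 2 := by
  obtain ⟨f, hf⟩ := hq.exists_coord
  rw [hf] at hu ⊢
  rw [hf, hf]
  generalize f.repr u 0 = a at *
  generalize f.repr u 1 = b at *
  generalize f.repr u 2 = c at *
  generalize f.repr w 0 = x at *
  generalize f.repr w 1 = y at *
  generalize f.repr w 2 = z at *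
  have hc : 0 < c ^ 2 := by nlinarith [sq_nonneg a, sq_nonneg b]
  -- By Lagrange's identity the claim is (ay - bx)² ≤ (az - cx)² + (bz - cy)². Multiplied by c², it
  -- follows from Cauchy-Schwarz and a² + b² < c².
  have key : (c ^ 2) * (a * y - b * x) ^ 2 ≤
      c ^ 2 * ((a * z - c * x) ^ 2 + (b * z - c * y) ^ 2) := by
    have h1 : c * (a * y - b * x) = b * (a * z - c * x) - a * (b * z - c * y) := by ring
    have h2 : (b * (a * z - c * x) - a * (b * z - c * y)) ^ 2 ≤
        (a ^ 2 + b ^ 2) * ((a * z - c * x) ^ 2 + (b * z - c * y) ^ 2) := by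
      nlinarith [sq_nonneg (a * (a * z - c * x) + b * (b * z - c * y))]
    rw [← mul_pow, h1]
    refine h2.trans (mul_le_mul_of_nonneg_right (by nlinarith) (by positivity))
  have := le_of_mul_le_mul_left key hc
  nlinarith

theorem IsLorentzian.planeDet_neg (hq : IsLorentzian q) (h : gram q 2 2 < 0) :
    planeDet q < 0 := by
  have h1 : planeDet q ≤ 0 := by
    have := hq.mul_le_sq h (coordBasis lam 1)
    change gram q 2 2 * gram q 1 1 ≤ gram q 2 1 ^ 2 at this
    rw [planeDet, gram_comm hq.symm 1 2]
    linarith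
  refine h1.lt_of_ne fun h0 => ?_
  -- If `planeDet q` were 0, this identity would equate a product of two negative numbers with minus
  -- a square.
  have h2 : gram q 2 2 * gramDet q =
      gram q 2 2 * gram q 0 0 * planeDet q - gram q 0 2 ^ 2 * planeDet q
      - (gram q 0 1 * gram q 2 2 - gram q 1 2 * gram q 0 2) ^ 2 := by
    rw [gramDet, planeDet]; ring
  rw [h0] at h2
  nlinarith [mul_pos_of_neg_of_neg h hq.gramDet_neg]

end Lorentzian

/-! ### The Euler-Arnold equation -/

theorem hasDerivAt_bilinForm (q : LinearMap.BilinForm ℝ (LieAlg lam)) {u v : ℝ → LieAlg lam}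
    {u' v' : LieAlg lam} {t : ℝ} (hu : HasDerivAt u u' t) (hv : HasDerivAt v v' t) :
    HasDerivAt (fun t => q (u t) (v t)) (q u' (v t) + q (u t) v') t := by
  have h := ((LinearMap.toContinuousBilinearMap q).hasFDerivAt.comp_hasDerivAt t hu).clm_apply hv
  exact h

theorem hasDerivAt_coord {v : ℝ → LieAlg lam} {v' : LieAlg lam} {t : ℝ} (hv : HasDerivAt v v' t)
    (i : Fin 3) : HasDerivAt (fun t => v t i) (v' i) t :=
  hasDerivAt_pi.1 ((LieAlg.coord lam).hasFDerivAt.comp_hasDerivAt t hv) i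

/-- The curve `V` solves the Euler-Arnold equation `q (V', w) = q (V, ⁅V, w⁆)` on `s`. -/
def SolvesEulerArnold (q : LinearMap.BilinForm ℝ (LieAlg lam)) (V : ℝ → LieAlg lam)
    (s : Set ℝ) : Prop :=
  ∀ t ∈ s, ∃ V' : LieAlg lam, HasDerivAt V V' t ∧ ∀ w, q V' w = q (V t) ⁅V t, w⁆

theorem solvesEulerArnold_of_isIntegralCurveOn {q : LinearMap.BilinForm ℝ (LieAlg lam)}
    (hq : q.Nondegenerate) {V : ℝ → LieAlg lam} {s : Set ℝ} (hs : IsOpen s)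
    (h : IsIntegralCurveOn V (fun _ => geodesicField q hq) s) : SolvesEulerArnold q V s :=
  fun t ht => ⟨_, (h t ht).hasDerivAt (hs.mem_nhds ht), geodesicField_spec q hq (V t)⟩

/-- A function with vanishing derivative on an open interval is constant. -/
theorem eq_of_hasDerivAt_zero {f : ℝ → ℝ} {s : Set ℝ} (hs : IsOpen s) (hs' : s.OrdConnected)
    (hf : ∀ t ∈ s, HasDerivAt f 0 t) {t t₀ : ℝ} (ht : t ∈ s) (ht₀ : t₀ ∈ s) : f t = f t₀ :=
  hs.is_const_of_deriv_eq_zero hs'.isPreconnected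
    (fun x hx => (hf x hx).differentiableAt.differentiableWithinAt)
    (fun x hx => (hf x hx).deriv) ht ht₀

/-- Solution of a scalar linear equation. -/
theorem eq_mul_exp_of_hasDerivAt {f x v : ℝ → ℝ} {μ : ℝ} {s : Set ℝ} (hs : IsOpen s)
    (hs' : s.OrdConnected) (hx : ∀ t ∈ s, HasDerivAt x (v t) t)
    (hf : ∀ t ∈ s, HasDerivAt f (μ * v t * f t) t) {t t₀ : ℝ} (ht : t ∈ s) (ht₀ : t₀ ∈ s)
    (hx₀ : x t₀ = 0) : f t = f t₀ * Real.exp (μ * x t) := by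
  have h : ∀ r ∈ s, HasDerivAt (fun r => f r * Real.exp (-(μ * x r))) 0 r := by
    intro r hr
    exact ((hf r hr).fun_mul (((hx r hr).const_mul μ).fun_neg.exp)).congr_deriv (by ring)
  have := eq_of_hasDerivAt_zero hs hs' h ht ht₀
  rw [hx₀, mul_zero, neg_zero, Real.exp_zero, mul_one] at this
  rw [← this, mul_assoc, ← Real.exp_add, neg_add_cancel, Real.exp_zero, mul_one]

/-- Primitives on open intervals. -/
theorem exists_primitive {v : ℝ → ℝ} {s : Set ℝ} (hs : IsOpen s) (hs' : s.OrdConnected)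
    (hv : ContinuousOn v s) {t₀ : ℝ} (ht₀ : t₀ ∈ s) :
    ∃ x : ℝ → ℝ, x t₀ = 0 ∧ ∀ t ∈ s, HasDerivAt x (v t) t := by
  refine ⟨fun t => ∫ r in t₀..t, v r, intervalIntegral.integral_same, fun t ht => ?_⟩
  refine intervalIntegral.integral_hasDerivAt_right
    ((hv.mono (hs'.uIcc_subset ht₀ ht)).intervalIntegrable)
    (hv.stronglyMeasurableAtFilter hs t ht) (hv.continuousAt (hs.mem_nhds ht))

/-! ### Conservation laws and reduction to one degree of freedom -/

namespace SolvesEulerArnold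

variable {q : LinearMap.BilinForm ℝ (LieAlg lam)} {V : ℝ → LieAlg lam} {s : Set ℝ}

theorem hasDerivAt_momentum (h : SolvesEulerArnold q V s) {t : ℝ} (ht : t ∈ s) (w : LieAlg lam) :
    HasDerivAt (fun t => q (V t) w) (q (V t) ⁅V t, w⁆) t := by
  obtain ⟨V', hV, hw⟩ := h t ht
  simpa [hw] using hasDerivAt_bilinForm q hV (hasDerivAt_const t w)

theorem continuousOn_coord (h : SolvesEulerArnold q V s) (i : Fin 3) :
    ContinuousOn (fun t => V t i) s := fun t ht =>
  let ⟨_, hV, _⟩ := h t ht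
  (hasDerivAt_coord hV i).continuousAt.continuousWithinAt

/-- The derivative is 2 q(V, [V, V]) = 0. -/
theorem energy_eq (hq : q.IsSymm) (h : SolvesEulerArnold q V s) (hs : IsOpen s)
    (hs' : s.OrdConnected) {t t₀ : ℝ} (ht : t ∈ s) (ht₀ : t₀ ∈ s) :
    q (V t) (V t) = q (V t₀) (V t₀) := by
  refine eq_of_hasDerivAt_zero (f := fun t => q (V t) (V t)) hs hs' (fun r hr => ?_) ht ht₀
  obtain ⟨V', hV, hw⟩ := h r hr
  convert hasDerivAt_bilinForm q hV hV using 1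
  rw [← hq.eq V' (V r)]
  simp [hw]

variable {x : ℝ → ℝ}

/-- As e₂ is an eigenvector of ad V modulo nothing but the abelian plane, [V, e₂] = x' e₂ and the
momentum obeys a scalar linear equation. -/
theorem momentum_one_eq (h : SolvesEulerArnold q V s) (hs : IsOpen s) (hs' : s.OrdConnected)
    (hx : ∀ t ∈ s, HasDerivAt x (V t 0) t) {t t₀ : ℝ} (ht : t ∈ s) (ht₀ : t₀ ∈ s)
    (hx₀ : x t₀ = 0) :
    q (V t) (coordBasis lam 1) = q (V t₀) (coordBasis lam 1) * Real.exp (x t) := by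
  have := eq_mul_exp_of_hasDerivAt (f := fun t => q (V t) (coordBasis lam 1)) (μ := 1) hs hs' hx
    (fun r hr => by
      convert h.hasDerivAt_momentum hr (coordBasis lam 1) using 1
      simp [apply_lie_eq, coordBasis_apply]) ht ht₀ hx₀
  simpa using this

theorem momentum_two_eq (h : SolvesEulerArnold q V s) (hs : IsOpen s) (hs' : s.OrdConnected)
    (hx : ∀ t ∈ s, HasDerivAt x (V t 0) t) {t t₀ : ℝ} (ht : t ∈ s) (ht₀ : t₀ ∈ s)
    (hx₀ : x t₀ = 0) :
    q (V t) (coordBasis lam 2) = q (V t₀) (coordBasis lam 2) * Real.exp (lam * x t) :=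
  eq_mul_exp_of_hasDerivAt (f := fun t => q (V t) (coordBasis lam 2)) hs hs' hx
    (fun r hr => by
      convert h.hasDerivAt_momentum hr (coordBasis lam 2) using 1
      simp [apply_lie_eq, coordBasis_apply]) ht ht₀ hx₀

/-- The first coordinate of a solution moves in a one-dimensional potential. -/
theorem gramDet_mul_sq_eq (hq : q.IsSymm) (h : SolvesEulerArnold q V s) (hs : IsOpen s)
    (hs' : s.OrdConnected) (hx : ∀ t ∈ s, HasDerivAt x (V t 0) t) {t t₀ : ℝ} (ht : t ∈ s)
    (ht₀ : t₀ ∈ s) (hx₀ : x t₀ = 0) :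
    gramDet q * V t 0 ^ 2 = planeDet q * q (V t₀) (V t₀)
      - dualForm q (q (V t₀) (coordBasis lam 1) * Real.exp (x t))
        (q (V t₀) (coordBasis lam 2) * Real.exp (lam * x t)) := by
  rw [gramDet_mul_sq hq, h.energy_eq hq hs hs' ht ht₀, h.momentum_one_eq hs hs' hx ht ht₀ hx₀,
    h.momentum_two_eq hs hs' hx ht ht₀ hx₀]

end SolvesEulerArnold

/-! ### Bounds for the potential -/

theorem exists_mul_exp_le (hlam : |lam| < 1) {α : ℝ} (hα : 0 < α) (β : ℝ) :
    ∃ M, ∀ x : ℝ, β * (Real.exp x * Real.exp (lam * x)) ≤ α * Real.exp x ^ 2 + M := by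
  obtain ⟨hl, hu⟩ := abs_lt.1 hlam
  -- At Y the factor α e^{(1-lam)x} reaches |β| + α. Left of Y the mixed term is at most its value
  -- at Y; right of Y the square dominates it. The summand 1 keeps the logarithm meaningful for β =
  -- 0.
  set Y := Real.log (|β| / α + 1) / (1 - lam) with hY
  have hpos : 0 < |β| / α + 1 := by positivity
  refine ⟨|β| * Real.exp ((1 + lam) * Y), fun x => ?_⟩
  have h1 : β * (Real.exp x * Real.exp (lam * x)) ≤ |β| * Real.exp ((1 + lam) * x) := by
    rw [← Real.exp_add, show x + lam * x = (1 + lam) * x by ring]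
    exact mul_le_mul_of_nonneg_right (le_abs_self β) (Real.exp_pos _).le
  refine h1.trans ?_
  rcases le_total x Y with hx | hx
  · have h2 : Real.exp ((1 + lam) * x) ≤ Real.exp ((1 + lam) * Y) :=
      Real.exp_le_exp.2 (mul_le_mul_of_nonneg_left hx (by linarith))
    have h3 := mul_le_mul_of_nonneg_left h2 (abs_nonneg β)
    have h4 : 0 ≤ α * Real.exp x ^ 2 := by positivity
    linarith
  · have h2 : |β| / α + 1 ≤ Real.exp ((1 - lam) * x) := by
      rw [← Real.log_le_iff_le_exp hpos]
      rw [hY, div_le_iff₀ (by linarith)] at hx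
      linarith
    have h3 : |β| ≤ α * Real.exp ((1 - lam) * x) := by
      have h := mul_le_mul_of_nonneg_left h2 hα.le
      rw [mul_add, mul_div_cancel₀ _ hα.ne'] at h
      linarith
    have h4 := mul_le_mul_of_nonneg_right h3 (Real.exp_pos ((1 + lam) * x)).le
    have h5 : α * Real.exp ((1 - lam) * x) * Real.exp ((1 + lam) * x) = α * Real.exp x ^ 2 := by
      rw [mul_assoc, ← Real.exp_add, sq, ← Real.exp_add]
      ring_nf
    have h6 : 0 ≤ |β| * Real.exp ((1 + lam) * Y) := by positivity
    linarith

/-- Half of the negative square of the first momentum absorbs the mixed term; for A = 0 there is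
nothing to absorb. -/
theorem exists_dualForm_le (hlam : |lam| < 1) {q : LinearMap.BilinForm ℝ (LieAlg lam)}
    (h : gram q 2 2 < 0) (A B : ℝ) :
    ∃ M, ∀ x : ℝ, dualForm q (A * Real.exp x) (B * Real.exp (lam * x)) ≤
      gram q 2 2 / 2 * (A * Real.exp x) ^ 2 + gram q 1 1 * (B * Real.exp (lam * x)) ^ 2 + M := by
  rcases eq_or_ne A 0 with rfl | hA
  · refine ⟨0, fun x => ?_⟩
    simp [dualForm]
  · have hα : 0 < -(gram q 2 2) / 2 * A ^ 2 := by
      have := sq_pos_of_ne_zero hA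
      exact mul_pos (by linarith) this
    obtain ⟨M, hM⟩ := exists_mul_exp_le hlam hα (-(2 * gram q 1 2 * (A * B)))
    refine ⟨M, fun x => ?_⟩
    have := hM x
    rw [dualForm]
    linear_combination this

/-! ### Bounded and unbounded integral curves -/

/-- The energy identity becomes a bound on a positive definite sum of squares of x' and the two
momenta. The other coordinates follow linearly, since the derived plane is nondegenerate. -/
theorem SolvesEulerArnold.isBounded_image {q : LinearMap.BilinForm ℝ (LieAlg lam)}
    (hlam : |lam| < 1) (hq : IsLorentzian q) (h22 : gram q 2 2 < 0) (h11 : gram q 1 1 < 0)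
    {V : ℝ → LieAlg lam} {s : Set ℝ} (hs : IsOpen s) (hs' : s.OrdConnected)
    (h : SolvesEulerArnold q V s) : Bornology.IsBounded (V '' s) := by
  rcases s.eq_empty_or_nonempty with rfl | ⟨t₀, ht₀⟩
  · simp
  obtain ⟨x, hx₀, hx⟩ := exists_primitive hs hs' (h.continuousOn_coord 0) ht₀
  obtain ⟨M, hM⟩ := exists_dualForm_le hlam h22 (q (V t₀) (coordBasis lam 1))
    (q (V t₀) (coordBasis lam 2))
  have hD := hq.gramDet_neg
  have hΔ := hq.planeDet_neg h22
  set K := M - planeDet q * q (V t₀) (V t₀) with hK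
  have key : ∀ t ∈ s, -gramDet q * V t 0 ^ 2 + -gram q 2 2 / 2 * q (V t) (coordBasis lam 1) ^ 2
      + -gram q 1 1 * q (V t) (coordBasis lam 2) ^ 2 ≤ K := by
    intro t ht
    have h1 := h.gramDet_mul_sq_eq hq.symm hs hs' hx ht ht₀ hx₀
    have h2 := hM (x t)
    rw [← h.momentum_one_eq hs hs' hx ht ht₀ hx₀, ← h.momentum_two_eq hs hs' hx ht ht₀ hx₀]
      at h1 h2
    linarith
  have aux : ∀ {a y : ℝ}, 0 < a → a * y ^ 2 ≤ K → |y| ≤ K / a + 1 := by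
    intro a y ha hy
    have : y ^ 2 ≤ K / a := by rwa [le_div_iff₀ ha, mul_comm]
    nlinarith [sq_abs y, sq_nonneg (|y| - 1), abs_nonneg y]
  have hsq : ∀ {a : ℝ} (y : ℝ), 0 < a → 0 ≤ a * y ^ 2 := fun y ha => by positivity
  have c0 : ∃ C, ∀ t ∈ s, |V t 0| ≤ C := ⟨_, fun t ht => aux (neg_pos.2 hD) (by
    have := key t ht
    have h1 := hsq (q (V t) (coordBasis lam 1)) (show 0 < -gram q 2 2 / 2 by linarith)
    have h2 := hsq (q (V t) (coordBasis lam 2)) (neg_pos.2 h11)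
    linarith)⟩
  have c1 : ∃ C, ∀ t ∈ s, |q (V t) (coordBasis lam 1)| ≤ C :=
    ⟨_, fun t ht => aux (show 0 < -gram q 2 2 / 2 by linarith) (by
      have := key t ht
      have h1 := hsq (V t 0) (neg_pos.2 hD)
      have h2 := hsq (q (V t) (coordBasis lam 2)) (neg_pos.2 h11)
      linarith)⟩
  have c2 : ∃ C, ∀ t ∈ s, |q (V t) (coordBasis lam 2)| ≤ C :=
    ⟨_, fun t ht => aux (neg_pos.2 h11) (by
      have := key t ht
      have h1 := hsq (V t 0) (neg_pos.2 hD)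
      have h2 := hsq (q (V t) (coordBasis lam 1)) (show 0 < -gram q 2 2 / 2 by linarith)
      linarith)⟩
  have cmul : ∀ (a : ℝ) {f : ℝ → ℝ}, (∃ C, ∀ t ∈ s, |f t| ≤ C) → ∃ C, ∀ t ∈ s, |a * f t| ≤ C :=
    fun a f ⟨C, hC⟩ => ⟨|a| * C, fun t ht => by
      rw [abs_mul]; exact mul_le_mul_of_nonneg_left (hC t ht) (abs_nonneg a)⟩
  have csub : ∀ {f g : ℝ → ℝ}, (∃ C, ∀ t ∈ s, |f t| ≤ C) → (∃ C, ∀ t ∈ s, |g t| ≤ C) →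
      ∃ C, ∀ t ∈ s, |f t - g t| ≤ C :=
    fun ⟨C, hC⟩ ⟨C', hC'⟩ => ⟨C + C', fun t ht =>
      (abs_sub _ _).trans (add_le_add (hC t ht) (hC' t ht))⟩
  have d1 : ∃ C, ∀ t ∈ s, |V t 1| ≤ C := by
    obtain ⟨C, hC⟩ := cmul (planeDet q)⁻¹ (csub (cmul (gram q 2 2) (csub c1 (cmul (gram q 0 1) c0)))
      (cmul (gram q 1 2) (csub c2 (cmul (gram q 0 2) c0))))
    refine ⟨C, fun t ht => ?_⟩
    have := hC t ht
    rwa [← planeDet_mul_coord_one hq.symm, inv_mul_cancel_left₀ hΔ.ne] at this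
  have d2 : ∃ C, ∀ t ∈ s, |V t 2| ≤ C := by
    obtain ⟨C, hC⟩ := cmul (planeDet q)⁻¹ (csub (cmul (gram q 1 1) (csub c2 (cmul (gram q 0 2) c0)))
      (cmul (gram q 1 2) (csub c1 (cmul (gram q 0 1) c0))))
    refine ⟨C, fun t ht => ?_⟩
    have := hC t ht
    rwa [← planeDet_mul_coord_two hq.symm, inv_mul_cancel_left₀ hΔ.ne] at this
  obtain ⟨C0, hC0⟩ := c0
  obtain ⟨C1, hC1⟩ := d1
  obtain ⟨C2, hC2⟩ := d2
  refine isBounded_iff_forall_norm_le.2 ⟨max (max C0 C1) C2, ?_⟩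
  rintro _ ⟨t, ht, rfl⟩
  have hnn : 0 ≤ max (max C0 C1) C2 :=
    (abs_nonneg _).trans ((hC0 t ht).trans (by simp))
  refine (pi_norm_le_iff_of_nonneg (x := (V t : Fin 3 → ℝ)) hnn).2 fun i => ?_
  fin_cases i
  · exact (hC0 t ht).trans (by simp)
  · exact (hC1 t ht).trans (by simp)
  · exact (hC2 t ht).trans (by simp)

theorem exists_unbounded_isIntegralCurve {q : LinearMap.BilinForm ℝ (LieAlg lam)}
    (hlam0 : lam ≠ 0) (hq : IsLorentzian q) (h22 : gram q 2 2 < 0) (h11 : gram q 1 1 = 0) :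
    ∃ γ : ℝ → LieAlg lam, IsIntegralCurve γ (fun _ => geodesicField q hq.nondegenerate) ∧
      ¬ Bornology.IsBounded (Set.range γ) := by
  have h12 : gram q 1 2 ≠ 0 := fun h0 => by
    have := hq.planeDet_neg h22
    rw [planeDet, h11, h0] at this
    simp at this
  -- c makes the first momentum vanish, b removes the constant part of the second. The first
  -- coordinate is 1, so x = t and the second momentum must be proportional to e^{lam t}.
  set c := -(gram q 0 1 / gram q 1 2) with hc
  set b := -((gram q 0 2 + c * gram q 2 2) / gram q 1 2) with hb
  set γ : ℝ → LieAlg lam := fun t => coordBasis lam 0 + b • coordBasis lam 1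
    + c • coordBasis lam 2 + Real.exp (lam * t) • coordBasis lam 1 with hγ
  have γ0 : ∀ t, γ t 0 = 1 := fun t => by
    simp [hγ, LieAlg.add_apply, LieAlg.smul_apply, coordBasis_apply]
  have γ1 : ∀ t, γ t 1 = b + Real.exp (lam * t) := fun t => by
    simp [hγ, LieAlg.add_apply, LieAlg.smul_apply, coordBasis_apply]
  have γ2 : ∀ t, γ t 2 = c := fun t => by
    simp [hγ, LieAlg.add_apply, LieAlg.smul_apply, coordBasis_apply]
  have hcb : c * gram q 1 2 = -gram q 0 1 := by rw [hc]; field_simp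
  have hbb : b * gram q 1 2 = -(gram q 0 2 + c * gram q 2 2) := by rw [hb]; field_simp
  have P1 : ∀ t, q (γ t) (coordBasis lam 1) = 0 := fun t => by
    rw [apply_coordBasis_one hq.symm, γ0, γ1, γ2, h11]
    linarith
  have P2 : ∀ t, q (γ t) (coordBasis lam 2) = Real.exp (lam * t) * gram q 1 2 := fun t => by
    rw [apply_coordBasis_two, γ0, γ1, γ2]
    linarith
  refine ⟨γ, fun t => ?_, fun hbd => ?_⟩
  · have hd : HasDerivAt γ ((Real.exp (lam * t) * lam) • coordBasis lam 1) t := by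
      have := ((hasDerivAt_id t).const_mul lam).exp.smul_const (coordBasis lam 1)
      rw [mul_one] at this
      exact this.const_add (coordBasis lam 0 + b • coordBasis lam 1 + c • coordBasis lam 2)
    refine hd.congr_deriv (Eq.symm (sub_eq_zero.1 (hq.nondegenerate.1 _ fun w => ?_)))
    rw [map_sub, LinearMap.sub_apply, geodesicField_spec, apply_lie_eq, P1, P2, γ0, γ2,
      map_smul, LinearMap.smul_apply, apply_eq_sum (coordBasis lam 1) w,
      apply_coordBasis_zero hq.symm, apply_coordBasis_one hq.symm, apply_coordBasis_two]
    simp only [coordBasis_apply, h11, smul_eq_mul, Fin.reduceEq, if_true, if_false]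
    linear_combination (-lam * w 0 * Real.exp (lam * t)) * hcb
  · obtain ⟨C, hC⟩ := isBounded_iff_forall_norm_le.1 hbd
    have h1 : ∀ t, |b + Real.exp (lam * t)| ≤ C := fun t => by
      rw [← γ1]
      exact (norm_le_pi_norm (γ t : Fin 3 → ℝ) 1).trans (hC _ ⟨t, rfl⟩)
    have hpos : 0 < |C| + |b| + 1 := by positivity
    -- The curve escapes as t → ∞ or t → -∞ according to the sign of lam; this time works for both.
    have h2 := h1 (Real.log (|C| + |b| + 1) / lam)
    rw [mul_div_cancel₀ _ hlam0, Real.exp_log hpos] at h2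
    have h3 := (le_abs_self _).trans h2
    linarith [le_abs_self C, neg_abs_le b]

/-! ### Geodesics and the Euler-Arnold equation -/

theorem leftTrivialization_eq (p v : LieGrp lam) :
    leftTrivialization p v = v 0 • coordBasis lam 0 + (Real.exp (-p 0) * v 1) • coordBasis lam 1
      + (Real.exp (-(lam * p 0)) * v 2) • coordBasis lam 2 := by
  have h : leftTrivialization p v =
      (![v 0, Real.exp (p⁻¹ 0) * v 1, Real.exp (lam * p⁻¹ 0) * v 2] : Fin 3 → ℝ) := by
    unfold leftTrivialization
    rw [ContinuousLinearMap.comp_apply, (hasFDerivAt_mul_left p⁻¹ p).fderiv]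
    apply LieAlg.ext <;> rfl
  rw [h, LieGrp.inv_zero_coord, mul_neg]
  apply LieAlg.ext <;> simp [LieAlg.add_apply, LieAlg.smul_apply, coordBasis_apply]

theorem leftTrivialization_zero_coord (p v : LieGrp lam) : leftTrivialization p v 0 = v 0 := by
  simp [leftTrivialization_eq, LieAlg.add_apply, LieAlg.smul_apply, coordBasis_apply]

theorem leftTrivialization_one_coord (p v : LieGrp lam) :
    leftTrivialization p v 1 = Real.exp (-p 0) * v 1 := by
  simp [leftTrivialization_eq, LieAlg.add_apply, LieAlg.smul_apply, coordBasis_apply]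

theorem leftTrivialization_two_coord (p v : LieGrp lam) :
    leftTrivialization p v 2 = Real.exp (-(lam * p 0)) * v 2 := by
  simp [leftTrivialization_eq, LieAlg.add_apply, LieAlg.smul_apply, coordBasis_apply]

theorem leftInvariantField_zero_coord (v : LieAlg lam) (p : LieGrp lam) :
    leftInvariantField v p 0 = v 0 := by
  rw [leftInvariantField_eq]; rfl

theorem leftInvariantField_one_coord (v : LieAlg lam) (p : LieGrp lam) :
    leftInvariantField v p 1 = Real.exp (p 0) * v 1 := by
  rw [leftInvariantField_eq]; rfl

theorem leftInvariantField_two_coord (v : LieAlg lam) (p : LieGrp lam) :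
    leftInvariantField v p 2 = Real.exp (lam * p 0) * v 2 := by
  rw [leftInvariantField_eq]; rfl

theorem leftTrivialization_leftInvariantField (v : LieAlg lam) (p : LieGrp lam) :
    leftTrivialization p (leftInvariantField v p) = v := by
  apply LieAlg.ext
  · rw [leftTrivialization_zero_coord, leftInvariantField_zero_coord]
  · rw [leftTrivialization_one_coord, leftInvariantField_one_coord, ← mul_assoc, ← Real.exp_add,
      neg_add_cancel, Real.exp_zero, one_mul]
  · rw [leftTrivialization_two_coord, leftInvariantField_two_coord, ← mul_assoc, ← Real.exp_add,
      neg_add_cancel, Real.exp_zero, one_mul]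

theorem leftInvariantField_leftTrivialization (p v : LieGrp lam) :
    leftInvariantField (leftTrivialization p v) p = v := by
  apply LieGrp.ext
  · rw [leftInvariantField_zero_coord, leftTrivialization_zero_coord]
  · rw [leftInvariantField_one_coord, leftTrivialization_one_coord, ← mul_assoc, ← Real.exp_add,
      add_neg_cancel, Real.exp_zero, one_mul]
  · rw [leftInvariantField_two_coord, leftTrivialization_two_coord, ← mul_assoc, ← Real.exp_add,
      add_neg_cancel, Real.exp_zero, one_mul]

/-- The first coordinate of a tangent vector of the group. -/
def projZero (lam : ℝ) : LieGrp lam →L[ℝ] ℝ :=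
  (ContinuousLinearMap.proj (R := ℝ) (φ := fun _ : Fin 3 => ℝ) 0).comp
    (LieGrp.coord lam : LieGrp lam →L[ℝ] (Fin 3 → ℝ))

theorem projZero_apply (v : LieGrp lam) : projZero lam v = v 0 := rfl

theorem lie_coordBasis_zero_leftTrivialization (p v : LieGrp lam) :
    ⁅coordBasis lam 0, leftTrivialization p v⁆ = (Real.exp (-p 0) * v 1) • coordBasis lam 1
      + (Real.exp (-(lam * p 0)) * (lam * v 2)) • coordBasis lam 2 := by
  rw [lie_eq_sum_coordBasis, leftTrivialization_one_coord, leftTrivialization_two_coord]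
  simp [coordBasis_apply, mul_left_comm]

/-- In the chart, left trivialization at p is exp(-p₀ ad e₁), so differentiating it brings down -ad
e₁. -/
theorem hasFDerivAt_leftTrivialization (p v : LieGrp lam) :
    HasFDerivAt (fun x => leftTrivialization x v)
      (-(projZero lam).smulRight ⁅coordBasis lam 0, leftTrivialization p v⁆) p := by
  have h0 : HasFDerivAt (fun x : LieGrp lam => x 0) (projZero lam) p := (projZero lam).hasFDerivAt
  have h1 := (h0.neg.exp.mul_const (v 1)).smul_const (coordBasis lam 1)
  have h2 := ((h0.const_mul lam).neg.exp.mul_const (v 2)).smul_const (coordBasis lam 2)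
  have h := ((hasFDerivAt_const (v 0 • coordBasis lam 0) p).add h1).add h2
  rw [show (fun x => leftTrivialization x v) = _ from funext fun x => leftTrivialization_eq x v]
  refine h.congr_fderiv ?_
  rw [lie_coordBasis_zero_leftTrivialization]
  refine ContinuousLinearMap.ext fun k => ?_
  simp only [add_apply, ContinuousLinearMap.smulRight_apply,
    neg_apply, smul_apply, zero_apply,
    projZero_apply, smul_eq_mul]
  module

theorem hasDerivAt_leftTrivialization {γ u : ℝ → LieGrp lam} {γ' u' : LieGrp lam} {t : ℝ}
    (hγ : HasDerivAt γ γ' t) (hu : HasDerivAt u u' t) :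
    HasDerivAt (fun t => leftTrivialization (γ t) (u t)) (leftTrivialization (γ t) u'
      - γ' 0 • ⁅coordBasis lam 0, leftTrivialization (γ t) (u t)⁆) t := by
  have hc : ∀ {c : ℝ → LieGrp lam} {c' : LieGrp lam} (i : Fin 3), HasDerivAt c c' t →
      HasDerivAt (fun t => c t i) (c' i) t := fun i h =>
    hasDerivAt_pi.1 ((LieGrp.coord lam).hasFDerivAt.comp_hasDerivAt t h) i
  have h1 := ((hc 0 hγ).neg.exp.mul (hc 1 hu)).smul_const (coordBasis lam 1)
  have h2 := (((hc 0 hγ).const_mul lam).neg.exp.mul (hc 2 hu)).smul_const (coordBasis lam 2)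
  have h := (((hc 0 hu).smul_const (coordBasis lam 0)).add h1).add h2
  rw [show (fun t => leftTrivialization (γ t) (u t)) = _ from
    funext fun t => leftTrivialization_eq (γ t) (u t)]
  refine h.congr_deriv ?_
  rw [lie_coordBasis_zero_leftTrivialization, leftTrivialization_eq]
  module

theorem fderiv_leftInvariantMetric (q : LinearMap.BilinForm ℝ (LieAlg lam)) (p u v w : LieGrp lam) :
    fderiv ℝ (fun x => leftInvariantMetric q x v w) p u =
      -(u 0 * (q ⁅coordBasis lam 0, leftTrivialization p v⁆ (leftTrivialization p w)
        + q (leftTrivialization p v) ⁅coordBasis lam 0, leftTrivialization p w⁆)) := by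
  have h := (LinearMap.toContinuousBilinearMap q).hasFDerivAt_of_bilinear
    (hasFDerivAt_leftTrivialization p v) (hasFDerivAt_leftTrivialization p w)
  have h' : fderiv ℝ (fun x => leftInvariantMetric q x v w) p = _ := h.fderiv
  rw [h']
  simp [projZero_apply]
  ring

theorem christoffelFirst_leftInvariantMetric {q : LinearMap.BilinForm ℝ (LieAlg lam)}
    (hq : q.IsSymm) (p u w : LieGrp lam) :
    christoffelFirst (leftInvariantMetric q) p u u w =
      -(u 0 * (q ⁅coordBasis lam 0, leftTrivialization p u⁆ (leftTrivialization p w)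
        + q (leftTrivialization p u) ⁅coordBasis lam 0, leftTrivialization p w⁆))
      + w 0 * q (leftTrivialization p u) ⁅coordBasis lam 0, leftTrivialization p u⁆ := by
  rw [christoffelFirst, fderiv_leftInvariantMetric, fderiv_leftInvariantMetric,
    ← hq.eq (leftTrivialization p u) ⁅coordBasis lam 0, leftTrivialization p u⁆]
  simp
  ring

theorem lie_eq_smul_sub_smul (v w : LieAlg lam) :
    ⁅v, w⁆ = v 0 • ⁅coordBasis lam 0, w⁆ - w 0 • ⁅coordBasis lam 0, v⁆ := by
  simp only [lie_eq_sum_coordBasis, coordBasis_apply]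
  simp
  module

/-- A curve in the group is a geodesic if and only if its left-trivialized velocity solves the
Euler-Arnold equation. -/
theorem isGeodesic_leftInvariantMetric_iff {q : LinearMap.BilinForm ℝ (LieAlg lam)}
    (hq : q.IsSymm) {γ : ℝ → LieGrp lam} (hγ : ContDiff ℝ 2 γ) :
    IsGeodesic (leftInvariantMetric q) γ ↔
      SolvesEulerArnold q (fun t => leftTrivialization (γ t) (deriv γ t)) Set.univ := by
  have hd : ∀ t, HasDerivAt γ (deriv γ t) t := fun t =>
    (hγ.differentiable (by norm_num) t).hasDerivAt
  have hdd : ∀ t, HasDerivAt (deriv γ) (deriv (deriv γ) t) t := fun t =>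
    (((contDiff_succ_iff_deriv (n := 1)).1 hγ).2.2.differentiable (by norm_num) t).hasDerivAt
  have hV := fun t => hasDerivAt_leftTrivialization (hd t) (hdd t)
  have key : ∀ t w, leftInvariantMetric q (γ t) (deriv (deriv γ) t) w
      + christoffelFirst (leftInvariantMetric q) (γ t) (deriv γ t) (deriv γ t) w
      = q (leftTrivialization (γ t) (deriv (deriv γ) t)
        - deriv γ t 0 • ⁅coordBasis lam 0, leftTrivialization (γ t) (deriv γ t)⁆)
          (leftTrivialization (γ t) w)
        - q (leftTrivialization (γ t) (deriv γ t))
          ⁅leftTrivialization (γ t) (deriv γ t), leftTrivialization (γ t) w⁆ := by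
    intro t w
    rw [christoffelFirst_leftInvariantMetric hq, leftInvariantMetric,
      lie_eq_smul_sub_smul (leftTrivialization (γ t) (deriv γ t)), leftTrivialization_zero_coord,
      leftTrivialization_zero_coord]
    simp only [map_sub, map_smul, LinearMap.sub_apply, LinearMap.smul_apply, smul_eq_mul]
    ring
  constructor
  · rintro ⟨-, h⟩ t -
    refine ⟨_, hV t, fun w => ?_⟩
    have := h t (leftInvariantField w (γ t))
    rw [key, leftTrivialization_leftInvariantField] at this
    exact sub_eq_zero.1 this
  · refine fun h => ⟨hγ, fun t w => ?_⟩
    obtain ⟨V', h1, h2⟩ := h t trivial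
    have h3 := h2 (leftTrivialization (γ t) w)
    rw [← (hV t).unique h1] at h3
    rw [key]
    exact sub_eq_zero.2 h3

/-! ### Blow-up in finite time -/

theorem exists_nonpos_of_deriv_le {z z' : ℝ → ℝ} {κ : ℝ} (hκ : 0 < κ)
    (hz : ∀ t, HasDerivAt z (z' t) t) (h : ∀ t, 0 ≤ t → z' t ≤ -κ) : ∃ t, z t ≤ 0 := by
  have hw : ∀ t, HasDerivAt (fun t => z t + κ * t) (z' t + κ) t := fun t => by
    simpa using (hz t).fun_add ((hasDerivAt_id t).const_mul κ)
  have hanti : AntitoneOn (fun t => z t + κ * t) (Set.Ici 0) :=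
    antitoneOn_of_deriv_nonpos (convex_Ici 0)
      (fun t _ => (hw t).continuousAt.continuousWithinAt)
      (fun t _ => (hw t).differentiableAt.differentiableWithinAt) fun t ht => by
        rw [interior_Ici] at ht
        rw [(hw t).deriv]
        linarith [h t (le_of_lt ht)]
  refine ⟨|z 0| / κ, ?_⟩
  have h0 : 0 ≤ |z 0| / κ := by positivity
  have := hanti (Set.self_mem_Ici) h0 h0
  simp only [mul_zero, add_zero, mul_div_cancel₀ _ hκ.ne'] at this
  linarith [le_abs_self (z 0)]

/-- By Darboux a nowhere vanishing derivative has constant sign, without any continuity; a positive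
sign is handled by reversing time. -/
theorem exists_nonpos_of_le_abs_deriv {z z' : ℝ → ℝ} {κ : ℝ} (hκ : 0 < κ)
    (hz : ∀ t, HasDerivAt z (z' t) t) (h : ∀ t, κ ≤ |z' t|) : ∃ t, z t ≤ 0 := by
  have hne : ∀ t, z' t ≠ 0 := fun t => abs_pos.1 (hκ.trans_le (h t))
  rcases hasDerivWithinAt_forall_lt_or_forall_gt_of_forall_ne convex_univ
    (fun t _ => (hz t).hasDerivWithinAt) (fun t _ => hne t) with h1 | h1
  · refine exists_nonpos_of_deriv_le hκ hz fun t _ => ?_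
    have := h t
    rw [abs_of_neg (h1 t trivial)] at this
    linarith
  · have hz' : ∀ t, HasDerivAt (fun t => z (-t)) (-z' (-t)) t := fun t => by
      exact ((hz (-t)).comp t (hasDerivAt_neg t)).congr_deriv (by ring)
    obtain ⟨t, ht⟩ := exists_nonpos_of_deriv_le hκ hz' fun t _ => by
      have := h (-t)
      rw [abs_of_pos (h1 (-t) trivial)] at this
      linarith
    exact ⟨-t, ht⟩

theorem hasDerivAt_exp_neg_mul {x : ℝ → ℝ} {v μ t : ℝ} (hx : HasDerivAt x v t) :
    HasDerivAt (fun t => Real.exp (-(μ * x t))) (-(μ * v * Real.exp (-(μ * x t)))) t :=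
  (hx.const_mul μ).fun_neg.exp.congr_deriv (by ring)

/-- Under z = e^{-μx}, the inequality C x'² ≥ e^{2μx} becomes |z'| ≥ |μ|/√C. -/
theorem le_abs_mul_exp_neg {x v μ C : ℝ} (h : Real.exp (μ * x) ^ 2 ≤ C * v ^ 2) (hC : 0 < C) :
    |μ| / √C ≤ |μ * v * Real.exp (-(μ * x))| := by
  have hs : 0 < √C := Real.sqrt_pos.2 hC
  have h1 : Real.exp (μ * x) ≤ √C * |v| := by
    refine le_of_sq_le_sq ?_ (by positivity)
    rwa [mul_pow, Real.sq_sqrt hC.le, sq_abs]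
  have h2 : 1 ≤ √C * (|v| * Real.exp (-(μ * x))) := by
    have := mul_le_mul_of_nonneg_right h1 (Real.exp_pos (-(μ * x))).le
    rwa [← Real.exp_add, add_neg_cancel, Real.exp_zero, mul_assoc] at this
  rw [abs_mul, abs_mul, Real.abs_exp, div_le_iff₀ hs, mul_assoc]
  have := mul_le_mul_of_nonneg_left h2 (abs_nonneg μ)
  linarith

/-- A global function cannot satisfy `C x'² ≥ e^{2μx}`. -/
theorem false_of_exp_sq_le {x v : ℝ → ℝ} {μ C : ℝ} (hμ : μ ≠ 0) (hC : 0 < C)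
    (hx : ∀ t, HasDerivAt x (v t) t) (h : ∀ t, Real.exp (μ * x t) ^ 2 ≤ C * v t ^ 2) : False := by
  have hκ : 0 < |μ| / √C := div_pos (abs_pos.2 hμ) (Real.sqrt_pos.2 hC)
  obtain ⟨t, ht⟩ := exists_nonpos_of_le_abs_deriv hκ
    (fun t => hasDerivAt_exp_neg_mul (μ := μ) (hx t)) fun t => by
      rw [abs_neg]
      exact le_abs_mul_exp_neg (h t) hC
  exact (Real.exp_pos _).not_ge ht

/-- A global function with positive initial velocity cannot satisfy `C x'² ≥ e^{2μx}` in the region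
above its initial value. -/
theorem false_of_exp_sq_le_of_nonneg {x v : ℝ → ℝ} {μ C : ℝ} (hμ : 0 < μ) (hC : 0 < C)
    (hx : ∀ t, HasDerivAt x (v t) t) (hx0 : x 0 = 0) (hv0 : 0 < v 0)
    (h : ∀ t, 0 ≤ x t → Real.exp (μ * x t) ^ 2 ≤ C * v t ^ 2) : False := by
  -- Let r maximize x on [0, t]. Then x r ≥ 0, so v r ≠ 0 and r is an endpoint; v 0 > 0 excludes 0
  -- with negative velocity, which leaves r = t with positive velocity.
  have main : ∀ t, 0 ≤ t → 0 ≤ x t ∧ 0 < v t := by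
    intro t ht
    obtain ⟨r, hr, hmax⟩ := (isCompact_Icc (a := 0) (b := t)).exists_isMaxOn ⟨0, le_rfl, ht⟩
      (fun r _ => (hx r).continuousAt.continuousWithinAt : ContinuousOn x _)
    have hxr : 0 ≤ x r := hx0 ▸ hmax ⟨le_rfl, ht⟩
    have hvr : v r ≠ 0 := fun h0 => by
      have := h r hxr
      rw [h0] at this
      have := Real.exp_pos (μ * x r)
      nlinarith
    have hcone : ∀ y ∈ Set.Icc 0 t, (y - r) * v r ≤ 0 := fun y hy => by
      have := hmax.localize.hasFDerivWithinAt_nonpos (hx r).hasFDerivAt.hasFDerivWithinAt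
        (sub_mem_posTangentConeAt_of_segment_subset ((convex_Icc 0 t).segment_subset hr hy))
      simpa using this
    rcases hvr.lt_or_gt with hneg | hpos
    · have h1 := hcone 0 ⟨le_rfl, ht⟩
      have h2 : r = 0 := by
        by_contra hne
        have := hr.1.lt_of_ne' hne
        nlinarith
      rw [h2] at hneg
      linarith
    · have h1 := hcone t ⟨ht, le_rfl⟩
      have h2 : r = t := by
        by_contra hne
        have := hr.2.lt_of_ne hne
        nlinarith
      rw [← h2]
      exact ⟨hxr, hpos⟩
  have hκ : 0 < |μ| / √C := div_pos (abs_pos.2 hμ.ne') (Real.sqrt_pos.2 hC)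
  obtain ⟨t, ht⟩ := exists_nonpos_of_deriv_le hκ
    (fun t => hasDerivAt_exp_neg_mul (μ := μ) (hx t)) fun t ht => by
      obtain ⟨h1, h2⟩ := main t ht
      have := le_abs_mul_exp_neg (h t h1) hC
      rw [abs_of_pos (by positivity : 0 < μ * v t * _)] at this
      linarith
  exact (Real.exp_pos _).not_ge ht

/-! ### Incomplete metrics -/

section Incomplete

variable {q : LinearMap.BilinForm ℝ (LieAlg lam)}

theorem exists_momentum (hq : IsLorentzian q) (a b c : ℝ) :
    ∃ v : LieAlg lam, q v (coordBasis lam 0) = a ∧ q v (coordBasis lam 1) = b ∧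
      q v (coordBasis lam 2) = c := by
  refine ⟨(LinearMap.BilinForm.toDual q hq.nondegenerate).symm
    ((coordBasis lam).constr ℝ ![a, b, c]), ?_, ?_, ?_⟩ <;>
  · rw [LinearMap.BilinForm.apply_toDual_symm_apply]
    simp

/-- With `planeDet q * q v v` ≤ 0 the energy term can be dropped from the identity, leaving a lower
bound for x'². A large first coordinate achieves this. -/
theorem exists_momentum_of_planeDet (hq : IsLorentzian q) (A B : ℝ) :
    ∃ v : LieAlg lam, q v (coordBasis lam 1) = A ∧ q v (coordBasis lam 2) = B ∧
      planeDet q * q v v ≤ 0 ∧ (planeDet q ≠ 0 → 0 < v 0) := by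
  have hG := hq.gramDet_neg
  rcases eq_or_ne (planeDet q) 0 with h | h
  · obtain ⟨v, -, h1, h2⟩ := exists_momentum hq 0 A B
    exact ⟨v, h1, h2, by simp [h], fun h' => absurd h h'⟩
  -- Chosen so that |D| N = |`dualForm q A B`| + |D|; as N ≥ 1, D N² + `dualForm q A B` ≤ 0.
  · set N := |dualForm q A B| / (-gramDet q) + 1 with hN
    have hN1 : 1 ≤ N := by
      have : 0 ≤ |dualForm q A B| / (-gramDet q) := div_nonneg (abs_nonneg _) (by linarith)
      linarith
    obtain ⟨v, h0, h1, h2⟩ := exists_momentum hq ((gramDet q * N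
      - (gram q 0 2 * gram q 1 2 - gram q 0 1 * gram q 2 2) * A
      - (gram q 0 1 * gram q 1 2 - gram q 0 2 * gram q 1 1) * B) / planeDet q) A B
    have hv := gramDet_mul_coord_zero hq.symm v
    rw [h0, h1, h2, mul_div_cancel₀ _ h] at hv
    have hvN : v 0 = N := mul_left_cancel₀ hG.ne (by linarith)
    refine ⟨v, h1, h2, ?_, fun _ => by linarith⟩
    have hsq := gramDet_mul_sq hq.symm v
    rw [h1, h2, hvN] at hsq
    have h3 : (-gramDet q) * N = |dualForm q A B| + (-gramDet q) := by
      rw [hN, mul_add, mul_div_cancel₀ _ (by linarith), mul_one]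
    have h4 : (-gramDet q) * N ≤ (-gramDet q) * N ^ 2 :=
      mul_le_mul_of_nonneg_left (by nlinarith) (by linarith)
    linarith [neg_abs_le (dualForm q A B), le_abs_self (dualForm q A B)]

theorem IsGeodesicallyComplete.exists_motion (hq : IsLorentzian q)
    (h : IsGeodesicallyComplete (leftInvariantMetric q)) (A B : ℝ) :
    ∃ x v : ℝ → ℝ, x 0 = 0 ∧ (planeDet q ≠ 0 → 0 < v 0) ∧ (∀ t, HasDerivAt x (v t) t) ∧
      ∀ t, dualForm q (A * Real.exp (x t)) (B * Real.exp (lam * x t)) ≤ -gramDet q * v t ^ 2 := by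
  obtain ⟨u, h1, h2, hE, hpos⟩ := exists_momentum_of_planeDet hq A B
  obtain ⟨γ, hγ, h0, h0'⟩ := h 1 (leftInvariantField u 1)
  have hV := (isGeodesic_leftInvariantMetric_iff hq.symm hγ.1).1 hγ
  set V := fun t => leftTrivialization (γ t) (deriv γ t) with hVdef
  have hV0 : V 0 = u := by
    rw [hVdef]
    simp only
    rw [h0, h0', leftTrivialization_leftInvariantField]
  have hx : ∀ t, HasDerivAt (fun t => γ t 0) (V t 0) t := fun t => by
    rw [hVdef]
    simp only
    rw [leftTrivialization_zero_coord]
    exact (projZero lam).hasFDerivAt.comp_hasDerivAt t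
      (hγ.1.differentiable (by norm_num) t).hasDerivAt
  have hx0 : γ 0 0 = 0 := by rw [h0]; rfl
  refine ⟨fun t => γ t 0, fun t => V t 0, hx0, fun h =>
    (hpos h).trans_eq (congrArg (fun w : LieAlg lam => w 0) hV0).symm, hx, fun t => ?_⟩
  have := hV.gramDet_mul_sq_eq hq.symm isOpen_univ Set.ordConnected_univ (fun t _ => hx t)
    (Set.mem_univ t) (Set.mem_univ 0) hx0
  rw [hV0, h1, h2] at this
  linarith

theorem IsGeodesicallyComplete.gram_one_one_nonpos (hlam0 : lam ≠ 0) (hq : IsLorentzian q)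
    (h : IsGeodesicallyComplete (leftInvariantMetric q)) : gram q 1 1 ≤ 0 := by
  by_contra! hpos
  obtain ⟨x, v, -, -, hx, hE⟩ := h.exists_motion hq 0 1
  refine false_of_exp_sq_le hlam0 (div_pos (neg_pos.2 hq.gramDet_neg) hpos) hx fun t => ?_
  have := hE t
  rw [dualForm] at this
  rw [div_mul_eq_mul_div, le_div_iff₀ hpos]
  linarith

theorem IsGeodesicallyComplete.gram_two_two_nonpos (hq : IsLorentzian q)
    (h : IsGeodesicallyComplete (leftInvariantMetric q)) : gram q 2 2 ≤ 0 := by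
  by_contra! hpos
  obtain ⟨x, v, -, -, hx, hE⟩ := h.exists_motion hq 1 0
  refine false_of_exp_sq_le one_ne_zero (div_pos (neg_pos.2 hq.gramDet_neg) hpos) hx fun t => ?_
  have := hE t
  rw [dualForm] at this
  rw [div_mul_eq_mul_div, le_div_iff₀ hpos, one_mul]
  linarith

/-- Without the e^{2x} term the mixed exponential dominates for x ≥ 0, and its coefficient can be
made positive through A. -/
theorem IsGeodesicallyComplete.gram_two_two_neg (hlam0 : lam ≠ 0) (hlam1 : |lam| < 1)
    (hq : IsLorentzian q) (h : IsGeodesicallyComplete (leftInvariantMetric q)) :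
    gram q 2 2 < 0 := by
  obtain ⟨hl, hu⟩ := abs_lt.1 hlam1
  refine (h.gram_two_two_nonpos hq).lt_of_ne fun h22 => ?_
  have h11 := h.gram_one_one_nonpos hlam0 hq
  have hG := hq.gramDet_neg
  have h12 : gram q 1 2 ≠ 0 := fun h0 => by
    rw [gramDet, planeDet, h22, h0] at hG
    nlinarith [mul_nonneg (neg_nonneg.2 h11) (sq_nonneg (gram q 0 2))]
  have hsq := sq_pos_of_ne_zero h12
  have hΔ : planeDet q ≠ 0 := by
    rw [planeDet, h22]
    linarith
  -- This A gives the mixed term the coefficient 1 - g₁₁, which leaves at least e^{(1+lam)x} after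
  -- compensating g₁₁ e^{2 lam x} on x ≥ 0.
  obtain ⟨x, v, hx0, hv0, hx, hE⟩ := h.exists_motion hq
    (-(1 - gram q 1 1) / (2 * gram q 1 2)) 1
  refine false_of_exp_sq_le_of_nonneg (μ := (1 + lam) / 2) (by linarith) (neg_pos.2 hG) hx hx0
    (hv0 hΔ) fun t ht => le_trans ?_ (hE t)
  have e1 : Real.exp ((1 + lam) / 2 * x t) ^ 2 = Real.exp (x t) * Real.exp (lam * x t) := by
    rw [sq, ← Real.exp_add, ← Real.exp_add]
    ring_nf
  have e2 : Real.exp (lam * x t) ^ 2 ≤ Real.exp (x t) * Real.exp (lam * x t) := by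
    rw [sq]
    exact mul_le_mul_of_nonneg_right (Real.exp_le_exp.2 (by nlinarith)) (Real.exp_pos _).le
  have e3 : dualForm q (-(1 - gram q 1 1) / (2 * gram q 1 2) * Real.exp (x t))
      (1 * Real.exp (lam * x t)) = (1 - gram q 1 1) * (Real.exp (x t) * Real.exp (lam * x t))
        + gram q 1 1 * Real.exp (lam * x t) ^ 2 := by
    rw [dualForm, h22]
    field_simp
    ring
  rw [e1, e3]
  nlinarith [mul_le_mul_of_nonneg_left e2 (neg_nonneg.2 h11)]

end Incomplete

/-! ### Motion in a potential that is bounded above -/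

open scoped Manifold in
/-- Integral curves on arbitrarily long intervals can be glued to a global one. -/
theorem exists_forall_hasDerivAt_of_forall_Ioo {E : Type*} [NormedAddCommGroup E]
    [NormedSpace ℝ E] [CompleteSpace E] {F : E → E} (hF : ContDiff ℝ 1 F) (z : E)
    (h : ∀ a, ∃ γ : ℝ → E, γ 0 = z ∧ ∀ t ∈ Set.Ioo (-a) a, HasDerivAt γ (F (γ t)) t) :
    ∃ γ : ℝ → E, γ 0 = z ∧ ∀ t, HasDerivAt γ (F (γ t)) t := by
  have h' : ∀ a, ∃ γ : ℝ → E, γ 0 = z ∧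
      IsMIntegralCurveOn (I := 𝓘(ℝ, E)) γ F (Set.Ioo (-a) a) := fun a => by
    obtain ⟨γ, h0, hγ⟩ := h a
    exact ⟨γ, h0, fun t ht => (hγ t ht).hasFDerivAt.hasMFDerivAt.hasMFDerivWithinAt⟩
  obtain ⟨γ, h0, hγ⟩ := (exists_isMIntegralCurve_iff_exists_isMIntegralCurveOn_Ioo
    (I := 𝓘(ℝ, E)) (contMDiff_vectorSpace_iff_contDiff.2 hF) z).2 h'
  refine ⟨γ, h0, fun t => ?_⟩
  have h1 : HasFDerivAt γ ((1 : ℝ →L[ℝ] ℝ).smulRight (F (γ t))) t := (hγ t).hasFDerivAt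
  simpa using h1.hasDerivAt

open scoped NNReal in
/-- A bounded Lipschitz field has integral curves on arbitrarily long intervals. -/
theorem exists_hasDerivAt_Ioo_of_lipschitzWith {E : Type*} [NormedAddCommGroup E]
    [NormedSpace ℝ E] [CompleteSpace E] {F : E → E} {K L : ℝ≥0} (hK : LipschitzWith K F)
    (hL : ∀ z, ‖F z‖ ≤ L) (z : E) {a : ℝ} (ha : 0 < a) :
    ∃ γ : ℝ → E, γ 0 = z ∧ ∀ t ∈ Set.Ioo (-a) a, HasDerivAt γ (F (γ t)) t := by
  have hpl : IsPicardLindelof (fun _ => F) (tmin := -a) (tmax := a)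
      ⟨0, Set.mem_Icc.2 ⟨by linarith, ha.le⟩⟩ z (L * a.toNNReal) 0 L K :=
    .of_time_independent (fun x _ => hL x) hK.lipschitzOnWith (by simp [ha.le])
  obtain ⟨γ, h0, hγ⟩ := hpl.exists_eq_forall_mem_Icc_hasDerivWithinAt₀
  exact ⟨γ, h0, fun t ht => (hγ t ⟨ht.1.le, ht.2.le⟩).hasDerivAt (Icc_mem_nhds ht.1 ht.2)⟩

/-- A priori bound: the speed only has to be controlled in the region that is reached. -/
theorem abs_sub_le_of_speed_lt {x v : ℝ → ℝ} {S a T : ℝ} (hS : 0 ≤ S) (hT : 0 ≤ T) (hTa : T ≤ a)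
    (hx : ∀ t ∈ Set.Icc 0 T, HasDerivAt x (v t) t)
    (h : ∀ t ∈ Set.Icc 0 T, |x t - x 0| ≤ S * a → |v t| < S) : |x T - x 0| ≤ S * T := by
  -- The speed matters only where |x t - x 0| = S t ≤ S a, which is inside the controlled region;
  -- strictness prevents crossing the barrier.
  exact image_norm_le_of_norm_deriv_right_lt_deriv_boundary (f := fun t => x t - x 0)
      (f' := v) (a := 0) (b := T) (B := fun t => S * t) (B' := fun _ => S)
      (fun t ht => ((hx t ht).continuousAt.continuousWithinAt.sub continuousWithinAt_const))
      (fun t ht => ((hx t ⟨ht.1, ht.2.le⟩).sub_const _).hasDerivWithinAt) (by simp)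
      (fun t => by simpa using (hasDerivAt_id t).const_mul S)
      (fun t ht he => h t ⟨ht.1, ht.2.le⟩ (he.le.trans
        (mul_le_mul_of_nonneg_left (ht.2.le.trans hTa) hS))) ⟨hT, le_rfl⟩

/-- The clamp to `[-R, R]`. -/
def clamp (R y : ℝ) : ℝ := max (-R) (min R y)

theorem lipschitzWith_clamp (R : ℝ) : LipschitzWith 1 (clamp R) :=
  (LipschitzWith.id.const_min _).const_max _

theorem abs_clamp_le {R : ℝ} (hR : 0 ≤ R) (y : ℝ) : |clamp R y| ≤ R :=
  abs_le.2 ⟨le_max_left _ _, max_le (by linarith) (min_le_left _ _)⟩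

theorem clamp_eq {R y : ℝ} (h : |y| ≤ R) : clamp R y = y := by
  rw [clamp, min_eq_right (abs_le.1 h).2, max_eq_right (abs_le.1 h).1]

/-- The truncated equation of motion `x'' = h (x)`. -/
theorem exists_truncated_motion {h : ℝ → ℝ} (hh : ContDiff ℝ 1 h) (x₀ v₀ : ℝ) {R a : ℝ}
    (hR : 0 ≤ R) (ha : 0 < a) :
    ∃ x v : ℝ → ℝ, x 0 = x₀ ∧ v 0 = v₀ ∧ ∀ t ∈ Set.Ioo (-a) a,
      HasDerivAt x (v t) t ∧ HasDerivAt v (h (clamp R (x t))) t := by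
  obtain ⟨K, hK⟩ := hh.contDiffOn.exists_lipschitzOnWith one_ne_zero
    (convex_Icc (-R) R) isCompact_Icc
  obtain ⟨H, hH⟩ := isCompact_Icc.exists_bound_of_continuousOn
    (hh.continuous.continuousOn (s := Set.Icc (-R) R))
  have hmem : ∀ y, clamp R y ∈ Set.Icc (-R) R := fun y => abs_le.1 (abs_clamp_le hR y)
  have hH0 : 0 ≤ H := (norm_nonneg _).trans (hH _ (hmem 0))
  -- The acceleration is at most H, so |v| ≤ W on (-a, a) and the clamp on the velocity is never
  -- active.
  set W := |v₀| + H * a with hW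
  have hW0 : 0 ≤ W := by positivity
  have hlip : LipschitzWith (K * 1) (fun y => h (clamp R y)) := by
    rw [← lipschitzOnWith_univ]
    exact hK.comp (lipschitzWith_clamp R).lipschitzOnWith fun y _ => hmem y
  have hF : LipschitzWith (max (1 * 1) (K * 1 * 1))
      (fun z : ℝ × ℝ => (clamp W z.2, h (clamp R z.1))) :=
    ((lipschitzWith_clamp W).comp LipschitzWith.prod_snd).prodMk
      (hlip.comp LipschitzWith.prod_fst)
  obtain ⟨γ, h0, hγ⟩ := exists_hasDerivAt_Ioo_of_lipschitzWith hF
    (L := ⟨max W H, hW0.trans (le_max_left _ _)⟩) (fun z => max_le_max (abs_clamp_le hW0 z.2)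
      (hH _ (hmem z.1))) (x₀, v₀) ha
  have hx : ∀ t ∈ Set.Ioo (-a) a, HasDerivAt (fun t => (γ t).1) (clamp W (γ t).2) t :=
    fun t ht => (hasFDerivAt_fst (p := γ t)).comp_hasDerivAt t (hγ t ht)
  have hv : ∀ t ∈ Set.Ioo (-a) a, HasDerivAt (fun t => (γ t).2) (h (clamp R (γ t).1)) t :=
    fun t ht => (hasFDerivAt_snd (p := γ t)).comp_hasDerivAt t (hγ t ht)
  have hvW : ∀ t ∈ Set.Ioo (-a) a, |(γ t).2| ≤ W := by
    intro t ht
    have h1 := (convex_Ioo (-a) a).norm_image_sub_le_of_norm_hasDerivWithin_le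
      (fun t ht => (hv t ht).hasDerivWithinAt) (fun t _ => hH _ (hmem _))
      (show (0 : ℝ) ∈ Set.Ioo (-a) a from ⟨by linarith, ha⟩) ht
    rw [h0, sub_zero, Real.norm_eq_abs, Real.norm_eq_abs] at h1
    have h2 : H * |t| ≤ H * a := mul_le_mul_of_nonneg_left (abs_lt.2 ht).le hH0
    have h3 := abs_sub_abs_le_abs_sub (γ t).2 v₀
    simp only at h1
    linarith
  refine ⟨fun t => (γ t).1, fun t => (γ t).2, congrArg Prod.fst h0, congrArg Prod.snd h0,
    fun t ht => ⟨?_, hv t ht⟩⟩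
  have := hx t ht
  rwa [clamp_eq (hvW t ht)] at this

/-- The equation of motion `x'' = G' (x)` has global solutions if `G` is bounded above. -/
theorem exists_global_motion {G h : ℝ → ℝ} (hh : ContDiff ℝ 1 h)
    (hG : ∀ y, HasDerivAt G (h y) y) {M : ℝ} (hM : ∀ y, G y ≤ M) (x₀ v₀ : ℝ) :
    ∃ x v : ℝ → ℝ, x 0 = x₀ ∧ v 0 = v₀ ∧
      ∀ t, HasDerivAt x (v t) t ∧ HasDerivAt v (h (x t)) t := by
  -- Energy conservation gives v² ≤ K, and K < (K + 1)² yields the strict speed bound S = K + 1.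
  set K := v₀ ^ 2 + 2 * (M - G x₀) with hK
  have hK0 : 0 ≤ K := by
    have := hM x₀
    have := sq_nonneg v₀
    linarith
  set S := K + 1 with hS
  have hF : ContDiff ℝ 1 (fun z : ℝ × ℝ => (z.2, h z.1)) :=
    contDiff_snd.prodMk (hh.comp contDiff_fst)
  obtain ⟨γ, h0, hγ⟩ := exists_forall_hasDerivAt_of_forall_Ioo hF (x₀, v₀) fun a => by
    rcases le_or_gt a 0 with ha | ha
    · exact ⟨fun _ => (x₀, v₀), rfl, fun t ht => by linarith [ht.1, ht.2]⟩
    set R := |x₀| + S * a with hRdef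
    have hR : 0 ≤ R := by positivity
    obtain ⟨x, v, hx0, hv0, hxv⟩ := exists_truncated_motion hh x₀ v₀ hR ha
    have hmem0 : (0 : ℝ) ∈ Set.Ioo (-a) a := ⟨by linarith, ha⟩
    have hcont : Continuous fun y => h (clamp R y) :=
      hh.continuous.comp (lipschitzWith_clamp R).continuous
    -- The truncated force has its own conserved energy, which agrees with the true one on [-R, R].
    -- The a priori bound then shows that the motion never leaves this interval.
    set GR : ℝ → ℝ := fun y => ∫ r in x₀..y, h (clamp R r) with hGR
    have hGR' : ∀ y, HasDerivAt GR (h (clamp R y)) y := fun y =>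
      intervalIntegral.integral_hasDerivAt_right (hcont.intervalIntegrable _ _)
        (hcont.stronglyMeasurableAtFilter _ _) hcont.continuousAt
    have hGRx : GR x₀ = 0 := intervalIntegral.integral_same
    have hx₀R : |x₀| ≤ R := le_add_of_nonneg_right (by positivity)
    have hGeq : ∀ y, |y| ≤ R → GR y = G y - G x₀ := by
      intro y hy
      rw [← intervalIntegral.integral_eq_sub_of_hasDerivAt (fun r _ => hG r)
        (hh.continuous.intervalIntegrable _ _)]
      refine intervalIntegral.integral_congr fun r hr => ?_
      have hsub : Set.uIcc x₀ y ⊆ Set.Icc (-R) R :=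
        Set.uIcc_subset_Icc (abs_le.1 hx₀R) (abs_le.1 hy)
      rw [clamp_eq (abs_le.2 (hsub hr))]
    have henergy : ∀ t ∈ Set.Ioo (-a) a, v t ^ 2 = v₀ ^ 2 + 2 * GR (x t) := by
      intro t ht
      have hd : ∀ t ∈ Set.Ioo (-a) a,
          HasDerivAt (fun t => v t ^ 2 - 2 * GR (x t)) 0 t := by
        intro t ht
        obtain ⟨h1, h2⟩ := hxv t ht
        exact ((h2.fun_pow 2).fun_sub (((hGR' (x t)).comp t h1).const_mul 2)).congr_deriv
          (by simp; ring)
      have := eq_of_hasDerivAt_zero isOpen_Ioo Set.ordConnected_Ioo hd ht hmem0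
      simp only [hx0, hv0, hGRx] at this
      linarith
    have hspeed : ∀ t ∈ Set.Ioo (-a) a, |x t - x 0| ≤ S * a → |v t| < S := by
      intro t ht hle
      have hxR : |x t| ≤ R := by
        have := abs_sub_abs_le_abs_sub (x t) x₀
        rw [hx0] at hle
        linarith
      have h1 := henergy t ht
      rw [hGeq _ hxR] at h1
      have h2 := hM (x t)
      refine abs_lt_of_sq_lt_sq ?_ (by linarith)
      nlinarith
    have hbound : ∀ t ∈ Set.Ioo (-a) a, |x t| ≤ R := by
      intro t ht
      have h1 : |x t - x 0| ≤ S * |t| := by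
        rcases le_total 0 t with h | h
        · rw [abs_of_nonneg h]
          refine abs_sub_le_of_speed_lt (by linarith) h ht.2.le (fun r hr => (hxv r ?_).1)
            (fun r hr => hspeed r ?_) <;>
          exact ⟨by linarith [hr.1], hr.2.trans_lt ht.2⟩
        · rw [abs_of_nonpos h]
          have := abs_sub_le_of_speed_lt (x := fun r => x (-r)) (v := fun r => -v (-r)) (S := S)
            (by linarith) (neg_nonneg.2 h) (show -t ≤ a by linarith [ht.1])
            (fun r hr => ((hxv (-r) ⟨by linarith [hr.2, ht.1], by linarith [hr.1]⟩).1.comp r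
              (hasDerivAt_neg r)).congr_deriv (by ring))
            (fun r hr => by
              rw [neg_zero, abs_neg]
              exact hspeed (-r) ⟨by linarith [hr.2, ht.1], by linarith [hr.1]⟩)
          simpa using this
      have h2 : S * |t| ≤ S * a := mul_le_mul_of_nonneg_left (abs_lt.2 ht).le (by linarith)
      have h3 := abs_sub_abs_le_abs_sub (x t) x₀
      rw [hx0] at h1
      linarith
    refine ⟨fun t => (x t, v t), by simp only [hx0, hv0], fun t ht => ?_⟩
    obtain ⟨h1, h2⟩ := hxv t ht
    rw [clamp_eq (hbound t ht)] at h2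
    exact h1.prodMk h2
  refine ⟨fun t => (γ t).1, fun t => (γ t).2, congrArg Prod.fst h0, congrArg Prod.snd h0,
    fun t => ⟨?_, ?_⟩⟩
  · exact (hasFDerivAt_fst (p := γ t)).comp_hasDerivAt t (hγ t)
  · exact (hasFDerivAt_snd (p := γ t)).comp_hasDerivAt t (hγ t)

/-! ### Complete metrics -/

section Complete

variable {q : LinearMap.BilinForm ℝ (LieAlg lam)}

theorem contDiff_group_of_coord {n : WithTop ℕ∞} {γ : ℝ → LieGrp lam}
    (h : ∀ i, ContDiff ℝ n fun t => γ t i) : ContDiff ℝ n γ :=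
  (LieGrp.coord lam).symm.contDiff.comp
    (contDiff_pi.2 h : ContDiff ℝ n fun t => LieGrp.coord lam (γ t))

theorem contDiff_one_of_hasDerivAt {f f' : ℝ → ℝ} (h : ∀ t, HasDerivAt f (f' t) t)
    (hf' : Continuous f') : ContDiff ℝ 1 f := by
  rw [contDiff_one_iff_deriv]
  refine ⟨fun t => (h t).differentiableAt, ?_⟩
  rwa [funext fun t => (h t).deriv]

/-- A solution of the Euler-Arnold equation, together with a primitive of its first coordinate,
integrates to a geodesic. -/
theorem exists_isGeodesic_of_solvesEulerArnold (hq : q.IsSymm) {V : ℝ → LieAlg lam} {x : ℝ → ℝ}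
    (hV : SolvesEulerArnold q V Set.univ) (hVc : ∀ i, ContDiff ℝ 1 fun t => V t i)
    (hx : ∀ t, HasDerivAt x (V t 0) t) (p : LieGrp lam) (hp : x 0 = p 0) :
    ∃ γ : ℝ → LieGrp lam, IsGeodesic (leftInvariantMetric q) γ ∧ γ 0 = p ∧
      deriv γ 0 = leftInvariantField (V 0) p := by
  have hxc : ContDiff ℝ 1 x := contDiff_one_of_hasDerivAt hx (hVc 0).continuous
  have hprim : ∀ {f : ℝ → ℝ} (c : ℝ), Continuous f →
      ∃ y : ℝ → ℝ, y 0 = c ∧ ∀ t, HasDerivAt y (f t) t := by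
    intro f c hf
    obtain ⟨y, hy0, hy⟩ := exists_primitive isOpen_univ Set.ordConnected_univ hf.continuousOn
      (Set.mem_univ 0)
    exact ⟨fun t => y t + c, by simp [hy0], fun t => (hy t trivial).add_const c⟩
  have c1 : ContDiff ℝ 1 fun t => Real.exp (x t) * V t 1 := hxc.exp.mul (hVc 1)
  have c2 : ContDiff ℝ 1 fun t => Real.exp (lam * x t) * V t 2 :=
    (contDiff_const.mul hxc).exp.mul (hVc 2)
  obtain ⟨y, hy0, hy⟩ := hprim (p 1) c1.continuous
  obtain ⟨z, hz0, hz⟩ := hprim (p 2) c2.continuous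
  set γ : ℝ → LieGrp lam := fun t => (![x t, y t, z t] : Fin 3 → ℝ) with hγ
  have hγ0 : γ 0 = p := LieGrp.ext hp hy0 hz0
  have hd : ∀ t, HasDerivAt γ (leftInvariantField (V t) (γ t)) t := by
    intro t
    refine (LieGrp.coord lam).symm.hasFDerivAt.comp_hasDerivAt t
      (hasDerivAt_pi.2 fun i => ?_ : HasDerivAt (fun t => LieGrp.coord lam (γ t))
        (LieGrp.coord lam (leftInvariantField (V t) (γ t))) t)
    rw [leftInvariantField_eq]
    fin_cases i
    · exact hx t
    · exact hy t
    · exact hz t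
  have hderiv : deriv γ = fun t => leftInvariantField (V t) (γ t) := funext fun t => (hd t).deriv
  have hC1 : ContDiff ℝ 1 (deriv γ) := by
    rw [hderiv]
    refine contDiff_group_of_coord fun i => ?_
    fin_cases i
    · have e0 : (fun t => leftInvariantField (V t) (γ t) 0) = fun t => V t 0 :=
        funext fun t => leftInvariantField_zero_coord _ _
      exact e0.symm ▸ hVc 0
    · have e1 : (fun t => leftInvariantField (V t) (γ t) 1) = fun t => Real.exp (x t) * V t 1 :=
        funext fun t => leftInvariantField_one_coord _ _
      exact e1.symm ▸ c1
    · have e2 : (fun t => leftInvariantField (V t) (γ t) 2) =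
          fun t => Real.exp (lam * x t) * V t 2 :=
        funext fun t => leftInvariantField_two_coord _ _
      exact e2.symm ▸ c2
  have hC2 : ContDiff ℝ 2 γ := (contDiff_succ_iff_deriv (n := 1)).2
    ⟨fun t => (hd t).differentiableAt, by simp, hC1⟩
  refine ⟨γ, (isGeodesic_leftInvariantMetric_iff hq hC2).2 ?_, hγ0, ?_⟩
  · rw [show (fun t => leftTrivialization (γ t) (deriv γ t)) = V from funext fun t => by
      rw [hderiv, leftTrivialization_leftInvariantField]]
    exact hV
  · rw [(hd 0).deriv, hγ0]

theorem isGeodesicallyComplete_of_gram (hlam1 : |lam| < 1) (hq : IsLorentzian q)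
    (h22 : gram q 2 2 < 0) (h11 : gram q 1 1 ≤ 0) :
    IsGeodesicallyComplete (leftInvariantMetric q) := by
  intro p u
  have hD := hq.gramDet_neg
  have hΔ := (hq.planeDet_neg h22).ne
  set V₀ := leftTrivialization p u
  -- The exponential factors compensate for x starting at p 0 instead of 0.
  set A := q V₀ (coordBasis lam 1) * Real.exp (-p 0) with hA
  set B := q V₀ (coordBasis lam 2) * Real.exp (-(lam * p 0)) with hB
  -- Dividing the energy identity by -2D gives x'²/2 = `dualForm`/c + const, whose derivative is x''
  -- = G'(x).
  set c := -(2 * gramDet q) with hc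
  have hcpos : 0 < c := by linarith
  -- the effective one-dimensional motion
  set G : ℝ → ℝ := fun y => dualForm q (A * Real.exp y) (B * Real.exp (lam * y)) / c with hG
  set h : ℝ → ℝ := fun y => (2 * gram q 2 2 * (A * Real.exp y) ^ 2
    - 2 * (1 + lam) * gram q 1 2 * ((A * Real.exp y) * (B * Real.exp (lam * y)))
    + 2 * lam * gram q 1 1 * (B * Real.exp (lam * y)) ^ 2) / c with hh
  have hhc : ContDiff ℝ 1 h := by
    rw [hh]
    fun_prop
  have hG' : ∀ y, HasDerivAt G (h y) y := by
    intro y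
    have h1 := (Real.hasDerivAt_exp y).const_mul A
    have h2 := (((hasDerivAt_id y).const_mul lam).exp).const_mul B
    have h3 := ((((h1.fun_pow 2).const_mul (gram q 2 2)).fun_sub
      ((h1.fun_mul h2).const_mul (2 * gram q 1 2))).fun_add
      ((h2.fun_pow 2).const_mul (gram q 1 1))).div_const c
    refine h3.congr_deriv ?_
    simp only [hh, id]
    norm_num
    ring
  obtain ⟨M, hM⟩ := exists_dualForm_le hlam1 h22 A B
  have hGM : ∀ y, G y ≤ M / c := by
    intro y
    refine div_le_div_of_nonneg_right ?_ hcpos.le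
    have h1 := hM y
    have h2 : gram q 2 2 / 2 * (A * Real.exp y) ^ 2 ≤ 0 :=
      mul_nonpos_of_nonpos_of_nonneg (by linarith) (sq_nonneg _)
    have h3 : gram q 1 1 * (B * Real.exp (lam * y)) ^ 2 ≤ 0 :=
      mul_nonpos_of_nonpos_of_nonneg h11 (sq_nonneg _)
    linarith
  obtain ⟨x, v, hx0, hv0, hxv⟩ := exists_global_motion hhc hG' hGM (p 0) (V₀ 0)
  have hxc : ContDiff ℝ 1 x := contDiff_one_of_hasDerivAt (fun t => (hxv t).1)
    (continuous_iff_continuousAt.2 fun t => (hxv t).2.continuousAt)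
  have hvc : ContDiff ℝ 1 v := contDiff_one_of_hasDerivAt (fun t => (hxv t).2)
    (hhc.continuous.comp hxc.continuous)
  -- reconstruction of the velocity from its momenta
  set c₁ := gram q 0 2 * gram q 1 2 - gram q 0 1 * gram q 2 2
  set c₂ := gram q 0 1 * gram q 1 2 - gram q 0 2 * gram q 1 1
  set P₁ : ℝ → ℝ := fun t => A * Real.exp (x t) with hP₁
  set P₂ : ℝ → ℝ := fun t => B * Real.exp (lam * x t) with hP₂
  -- `gramDet_mul_coord_zero` solved for the remaining momentum, so that V has first coordinate v.
  set P₀ : ℝ → ℝ := fun t => (gramDet q * v t - c₁ * P₁ t - c₂ * P₂ t) / planeDet q with hP₀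
  -- The q-dual basis turns the three momenta into a vector.
  obtain ⟨a₀, a00, a01, a02⟩ := exists_momentum hq 1 0 0
  obtain ⟨a₁, a10, a11, a12⟩ := exists_momentum hq 0 1 0
  obtain ⟨a₂, a20, a21, a22⟩ := exists_momentum hq 0 0 1
  set V : ℝ → LieAlg lam := fun t => P₀ t • a₀ + P₁ t • a₁ + P₂ t • a₂ with hV
  have hVq0 : ∀ t, q (V t) (coordBasis lam 0) = P₀ t := fun t => by simp [hV, a00, a10, a20]
  have hVq1 : ∀ t, q (V t) (coordBasis lam 1) = P₁ t := fun t => by simp [hV, a01, a11, a21]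
  have hVq2 : ∀ t, q (V t) (coordBasis lam 2) = P₂ t := fun t => by simp [hV, a02, a12, a22]
  have hVv : ∀ t, V t 0 = v t := fun t => by
    have h1 := gramDet_mul_coord_zero hq.symm (V t)
    rw [hVq0, hVq1, hVq2, hP₀] at h1
    simp only [mul_div_cancel₀ _ hΔ] at h1
    exact mul_left_cancel₀ hD.ne (by linarith)
  have hP₁' : ∀ t, HasDerivAt P₁ (v t * P₁ t) t := fun t =>
    ((hxv t).1.exp.const_mul A).congr_deriv (by simp only [hP₁]; ring)
  have hP₂' : ∀ t, HasDerivAt P₂ (lam * v t * P₂ t) t := fun t =>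
    (((hxv t).1.const_mul lam).exp.const_mul B).congr_deriv (by simp only [hP₂]; ring)
  -- The value is q(V, [V, e₁]); this component of the Euler-Arnold equation is where the equation
  -- for x'' enters.
  have hP₀' : ∀ t, HasDerivAt P₀ (-(V t 1 * P₁ t) - lam * (V t 2 * P₂ t)) t := by
    intro t
    refine (((((hxv t).2.const_mul (gramDet q)).fun_sub ((hP₁' t).const_mul c₁)).fun_sub
      ((hP₂' t).const_mul c₂)).div_const (planeDet q)).congr_deriv ?_
    have h1 := planeDet_mul_coord_one hq.symm (V t)
    have h2 := planeDet_mul_coord_two hq.symm (V t)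
    rw [hVv, hVq1, hVq2] at h1 h2
    have h3 : gramDet q * h (x t) = -(gram q 2 2 * P₁ t ^ 2
        - (1 + lam) * gram q 1 2 * (P₁ t * P₂ t) + lam * gram q 1 1 * P₂ t ^ 2) := by
      have hD' := hD.ne
      simp only [hh, hc, hP₁, hP₂]
      field_simp
    rw [div_eq_iff hΔ, h3]
    linear_combination P₁ t * h1 + lam * P₂ t * h2
  have hVsol : SolvesEulerArnold q V Set.univ := by
    intro t _
    refine ⟨_, (((hP₀' t).smul_const a₀).add ((hP₁' t).smul_const a₁)).add
      ((hP₂' t).smul_const a₂), fun w => ?_⟩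
    rw [apply_lie_eq, apply_eq_sum _ w, hVq1, hVq2, hVv]
    simp only [map_add, map_smul, LinearMap.add_apply, LinearMap.smul_apply, smul_eq_mul,
      a00, a01, a02, a10, a11, a12, a20, a21, a22]
    ring
  have hP₁c : ContDiff ℝ 1 P₁ := contDiff_const.mul hxc.exp
  have hP₂c : ContDiff ℝ 1 P₂ := contDiff_const.mul (contDiff_const.mul hxc).exp
  have hP₀c : ContDiff ℝ 1 P₀ := (((contDiff_const.mul hvc).sub (contDiff_const.mul hP₁c)).sub
    (contDiff_const.mul hP₂c)).div_const _
  have hVc : ∀ i, ContDiff ℝ 1 fun t => V t i := fun i =>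
    ((hP₀c.mul contDiff_const).add (hP₁c.mul contDiff_const)).add (hP₂c.mul contDiff_const)
  have hV0 : V 0 = V₀ := by
    have e1 : P₁ 0 = q V₀ (coordBasis lam 1) := by
      simp only [hP₁, hA, hx0]
      rw [mul_assoc, ← Real.exp_add, neg_add_cancel, Real.exp_zero, mul_one]
    have e2 : P₂ 0 = q V₀ (coordBasis lam 2) := by
      simp only [hP₂, hB, hx0]
      rw [mul_assoc, ← Real.exp_add, neg_add_cancel, Real.exp_zero, mul_one]
    have e0 : P₀ 0 = q V₀ (coordBasis lam 0) := by
      have h1 := gramDet_mul_coord_zero hq.symm V₀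
      rw [← e1, ← e2] at h1
      simp only [hP₀, hv0]
      rw [div_eq_iff hΔ]
      linarith
    have : V 0 - V₀ = 0 := hq.nondegenerate.1 _ fun w => by
      rw [map_sub, LinearMap.sub_apply, apply_eq_sum (V 0) w, apply_eq_sum V₀ w, hVq0, hVq1, hVq2,
        e0, e1, e2, sub_self]
    exact sub_eq_zero.1 this
  obtain ⟨γ, h1, h2, h3⟩ := exists_isGeodesic_of_solvesEulerArnold hq.symm hVsol hVc
    (fun t => by rw [hVv]; exact (hxv t).1) p hx0
  refine ⟨γ, h1, h2, ?_⟩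
  rw [h3, hV0, leftInvariantField_leftTrivialization]

end Complete

/-! ### Causal characters of the standard basis -/

theorem isTimelike_smul_coordBasis {q : LinearMap.BilinForm ℝ (LieAlg lam)} {b : ℝ} (hb : b ≠ 0)
    (i : Fin 3) : IsTimelike q (b • coordBasis lam i) ↔ gram q i i < 0 := by
  have : 0 < b * b := mul_self_pos.2 hb
  rw [IsTimelike, map_smul, map_smul, LinearMap.smul_apply, smul_eq_mul, smul_eq_mul, ← mul_assoc,
    ← not_le, mul_nonneg_iff_of_pos_left this, not_le]
  rfl

theorem not_isSpacelike_smul_coordBasis {q : LinearMap.BilinForm ℝ (LieAlg lam)} {b : ℝ}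
    (hb : b ≠ 0) (i : Fin 3) : ¬ IsSpacelike q (b • coordBasis lam i) ↔ gram q i i ≤ 0 := by
  have : 0 < b * b := mul_self_pos.2 hb
  have hne : b • coordBasis lam i ≠ 0 := smul_ne_zero hb ((coordBasis lam).ne_zero i)
  rw [IsSpacelike, map_smul, map_smul, LinearMap.smul_apply, smul_eq_mul, smul_eq_mul, ← mul_assoc,
    or_iff_right hne, mul_pos_iff_of_pos_left this, not_lt]
  rfl

theorem gram_eq_zero_of_isLightlike_smul {q : LinearMap.BilinForm ℝ (LieAlg lam)} {b : ℝ}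
    (hb : b ≠ 0) {i : Fin 3} (h : IsLightlike q (b • coordBasis lam i)) : gram q i i = 0 := by
  have := h.2
  rw [map_smul, map_smul, LinearMap.smul_apply, smul_eq_mul, smul_eq_mul, ← mul_assoc] at this
  exact (mul_eq_zero.1 this).resolve_left (mul_ne_zero hb hb)

end MetricLie

end

/-! ### The main theorem -/

theorem theorem1p2 (lam : ℝ) (hlam0 : 0 < |lam|) (hlam1 : |lam| < 1)
    (e : Module.Basis (Fin 3) ℝ (MetricLie.LieAlg lam)) (he : MetricLie.IsStandardBasis e)
    (q : LinearMap.BilinForm ℝ (MetricLie.LieAlg lam)) (hq : MetricLie.IsLorentzian q) :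
    (MetricLie.IsGeodesicallyComplete (MetricLie.leftInvariantMetric q) ↔
      MetricLie.IsTimelike q (e 2) ∧ ¬ MetricLie.IsSpacelike q (e 1)) ∧
    (MetricLie.IsTimelike q (e 2) → MetricLie.IsTimelike q (e 1) →
      ∀ (γ : ℝ → MetricLie.LieAlg lam) (s : Set ℝ), IsOpen s → s.OrdConnected →
        IsIntegralCurveOn γ (fun _ => MetricLie.geodesicField q hq.nondegenerate) s →
        Bornology.IsBounded (γ '' s)) ∧
    (MetricLie.IsTimelike q (e 2) → MetricLie.IsLightlike q (e 1) →
      ∃ γ : ℝ → MetricLie.LieAlg lam,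
        IsIntegralCurve γ (fun _ => MetricLie.geodesicField q hq.nondegenerate) ∧
        ¬ Bornology.IsBounded (Set.range γ)) := by
  have hlam : lam ≠ 0 := abs_pos.1 hlam0
  obtain ⟨⟨b, hb, he1⟩, c, hc, he2⟩ := he.exists_smul hlam hlam1
  rw [he1, he2, MetricLie.isTimelike_smul_coordBasis hc, MetricLie.isTimelike_smul_coordBasis hb,
    MetricLie.not_isSpacelike_smul_coordBasis hb]
  refine ⟨⟨fun h => ⟨h.gram_two_two_neg hlam hlam1 hq, h.gram_one_one_nonpos hlam hq⟩,
    fun h => MetricLie.isGeodesicallyComplete_of_gram hlam1 hq h.1 h.2⟩,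
    fun h22 h11 γ s hs hs' hγ => ?_, fun h22 h11 => ?_⟩
  · exact (MetricLie.solvesEulerArnold_of_isIntegralCurveOn hq.nondegenerate hs hγ).isBounded_image
      hlam1 hq h22 h11 hs hs'
  · exact MetricLie.exists_unbounded_isIntegralCurve hlam hq h22
      (MetricLie.gram_eq_zero_of_isLightlike_smul hb h11)
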